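/- Let $X$ be a smooth manifold (finite-dimensional, second countable, Hausdorff, without boundary). The ring $\widetilde{\mathbb C}=\mathcal E_M/\mathcal N$ of Colombeau generalized numbers consists of the nets $(z_\varepsilon)\in\mathbb C^{(0,1)}$ that are moderate, i.e. $|z_\varepsilon|=O(\varepsilon^{b})$ as $\varepsilon\to0$ for some $b\in\mathbb R$, modulo the negligible ones, i.e. those with $|z_\varepsilon|=O(\varepsilon^{b})$ for every $b\in\mathbb R$. Let $\widetilde{\mathbb R}\subseteq\widetilde{\mathbb C}$ be the subring of elements having a net of real numbers as a representative. The (special) Colombeau algebra $\mathcal G(X)=\mathcal E_M(X)/\mathcal N(X)$ is the commutative $\widetilde{\mathbb C}$-algebra of nets $(u_\varepsilon)_{\varepsilon\in(0,1)}$ of smooth functions $u_\varepsilon:X\to\mathbb C$ such that for every compact $K\subseteq X$ and every $k\in\mathbb N$ there is $b\in\mathbb R$ such that for all smooth vector fields $\xi_1,\dots,\xi_k$ on $X$ one has $\sup_{p\in K}|L_{\xi_1}\cdots L_{\xi_k}u_\varepsilon(p)|=O(\varepsilon^{b})$ as $\varepsilon\to0$, modulo those among them with $\sup_{p\in K}|u_\varepsilon(p)|=O(\varepsilon^{b})$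 for every compact $K\subseteq X$ and every $b\in\mathbb R$. The set $\widetilde X_c$ of compactly supported generalized points consists of the nets $(p_\varepsilon)\in X^{(0,1)}$ that lie in some compact subset of $X$ for all sufficiently small $\varepsilon$, where $(p_\varepsilon)$ and $(q_\varepsilon)$ are identified if the net $(d_h(p_\varepsilon,q_\varepsilon))$ is negligible, $d_h$ being the distance (equal to $\infty$ between different connected components) of a Riemannian metric $h$ on $X$; this does not depend on $h$. For $u\in\mathcal G(X)$ and $p\in\widetilde X_c$, the point value $u(p)\in\widetilde{\mathbb C}$ is the class of $(u_\varepsilon(p_\varepsilon))$, which does not depend on the representatives. A multiplicative linear functional on $\mathcal G(X)$ is a $\widetilde{\mathbb C}$-linear map $m:\mathcal G(X)\to\widetilde{\mathbb C}$ with $m(uv)=m(u)m(v)$ for all $u,v$. Theorem. 1. The surjective multiplicative linear functionals on $\mathcal G(X)$ are exactly the maps $\delta_p:\mathcal G(X)\to\widetilde{\mathbb C}$, $\delta_p(u)=u(p)$, with $p\in\widetilde X_c$. 2. If $X$ is non-empty, the multiplicative linear functionals on $\mathcal G(X)$ are exactly the maps $e\,\delta_p:\mathcal G(X)\to\widetilde{\mathbb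 C}$, $(e\,\delta_p)(u)=e\cdot u(p)$, with $p\in\widetilde X_c$ and $e\in\widetilde{\mathbb R}$ idempotent ($e^2=e$). -/

import Mathlib

open scoped Manifold ContDiff

namespace Colombeau

open Filter Topology Asymptotics Bundle

/-- The parameter set `(0, 1)` of all nets. -/
abbrev Param : Type := Set.Ioo (0 : ℝ) 1

/-- The filter on `(0, 1)` describing `ε → 0`. -/
def toZero : Filter Param := Filter.comap ((↑) : Param → ℝ) (𝓝 0)

/-- A net of complex numbers is moderate if it is `O(ε ^ b)` for some real `b`. -/
def IsModerate (z : Param → ℂ) : Prop :=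
  ∃ b : ℝ, z =O[toZero] fun ε : Param => (ε : ℝ) ^ b

/-- A net of complex numbers is negligible if it is `O(ε ^ b)` for every real `b`. -/
def IsNegligible (z : Param → ℂ) : Prop :=
  ∀ b : ℝ, z =O[toZero] fun ε : Param => (ε : ℝ) ^ b

theorem rpow_isBigO {a b : ℝ} (h : a ≤ b) :
    (fun ε : Param => (ε : ℝ) ^ b) =O[toZero] fun ε : Param => (ε : ℝ) ^ a := by
  refine IsBigO.of_bound 1 (Eventually.of_forall fun ε => ?_)
  rw [one_mul, Real.norm_of_nonneg (Real.rpow_nonneg ε.2.1.le _),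
    Real.norm_of_nonneg (Real.rpow_nonneg ε.2.1.le _)]
  exact Real.rpow_le_rpow_of_exponent_ge ε.2.1 ε.2.2.le h

theorem rpow_mul_rpow (a b : ℝ) :
    (fun ε : Param => (ε : ℝ) ^ a * (ε : ℝ) ^ b) = fun ε : Param => (ε : ℝ) ^ (a + b) := by
  funext ε
  rw [Real.rpow_add ε.2.1]

theorem IsNegligible.isModerate {z : Param → ℂ} (h : IsNegligible z) : IsModerate z := ⟨0, h 0⟩

theorem isModerate_const (c : ℂ) : IsModerate fun _ => c :=
  ⟨0, by simpa using isBigO_const_const c (one_ne_zero (α := ℝ)) toZero⟩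

/-- The ring of moderate nets of complex numbers. -/
def moderateNets : Subring (Param → ℂ) where
  carrier := {z | IsModerate z}
  mul_mem' := by
    rintro z w ⟨a, ha⟩ ⟨b, hb⟩
    refine ⟨a + b, ?_⟩
    rw [← rpow_mul_rpow]
    exact ha.mul hb
  one_mem' := isModerate_const 1
  add_mem' := by
    rintro z w ⟨a, ha⟩ ⟨b, hb⟩
    exact ⟨min a b, (ha.trans (rpow_isBigO (min_le_left _ _))).add
      (hb.trans (rpow_isBigO (min_le_right _ _)))⟩
  zero_mem' := isModerate_const 0
  neg_mem' := by
    rintro z ⟨a, ha⟩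
    exact ⟨a, ha.neg_left⟩

/-- The ideal of negligible nets in the ring of moderate nets. -/
def negligibleNets : Ideal moderateNets where
  carrier := {z | IsNegligible z.1}
  add_mem' := fun hz hw b => (hz b).add (hw b)
  zero_mem' := fun b => isBigO_zero _ _
  smul_mem' := by
    rintro ⟨z, a, ha⟩ w hw b
    have h := ha.mul (hw (b - a))
    rw [rpow_mul_rpow, add_sub_cancel] at h
    exact h

/-- The ring of (complex) Colombeau generalized numbers. -/
def GenNumber : Type := moderateNets ⧸ negligibleNets

noncomputable instance : CommRing GenNumber :=
  inferInstanceAs (CommRing (moderateNets ⧸ negligibleNets))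

/-- The generalized number represented by a moderate net. -/
noncomputable def GenNumber.mk : moderateNets →+* GenNumber := Ideal.Quotient.mk negligibleNets

/-- The moderate nets that consist of real numbers. -/
def realModerateNets : Subring moderateNets where
  carrier := {z | ∀ ε, (z.1 ε).im = 0}
  mul_mem' := by
    intro z w hz hw ε
    simp [Complex.mul_im, hz ε, hw ε]
  one_mem' := fun ε => by simp
  add_mem' := by
    intro z w hz hw ε
    simp [hz ε, hw ε]
  zero_mem' := fun ε => by simp
  neg_mem' := by
    intro z hz ε
    simp [hz ε]

/-- The subring of those generalized numbers that have a net of real numbers as a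
representative. -/
noncomputable def realGenNumbers : Subring GenNumber := realModerateNets.map GenNumber.mk

section SupBigO

variable {X : Type*}

/-- For a net `v` of functions on `X`: `sup_{p ∈ K} |v_ε(p)| = O(ε ^ b)` as `ε → 0`. -/
def SupBigO (K : Set X) (v : Param → X → ℂ) (b : ℝ) : Prop :=
  ∃ C : ℝ, ∀ᶠ ε : Param in toZero, ∀ p ∈ K, ‖v ε p‖ ≤ C * (ε : ℝ) ^ b

theorem SupBigO.mono {K : Set X} {v : Param → X → ℂ} {a b : ℝ} (h : SupBigO K v b) (hab : a ≤ b) :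
    SupBigO K v a := by
  obtain ⟨C, hC⟩ := h
  refine ⟨|C|, hC.mono fun ε hε p hp => (hε p hp).trans ?_⟩
  have h1 := Real.rpow_le_rpow_of_exponent_ge ε.2.1 ε.2.2.le hab
  have h2 := Real.rpow_nonneg ε.2.1.le b
  calc C * (ε : ℝ) ^ b ≤ |C| * (ε : ℝ) ^ b := by gcongr; exact le_abs_self C
    _ ≤ |C| * (ε : ℝ) ^ a := by gcongr

theorem SupBigO.add {K : Set X} {v w : Param → X → ℂ} {b : ℝ} (hv : SupBigO K v b)
    (hw : SupBigO K w b) : SupBigO K (v + w) b := by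
  obtain ⟨C, hC⟩ := hv
  obtain ⟨D, hD⟩ := hw
  refine ⟨C + D, (hC.and hD).mono fun ε hε p hp => ?_⟩
  rw [add_mul]
  exact (norm_add_le _ _).trans (add_le_add (hε.1 p hp) (hε.2 p hp))

theorem SupBigO.neg {K : Set X} {v : Param → X → ℂ} {b : ℝ} (hv : SupBigO K v b) :
    SupBigO K (-v) b := by
  obtain ⟨C, hC⟩ := hv
  refine ⟨C, hC.mono fun ε hε p hp => ?_⟩
  simpa using hε p hp

theorem SupBigO.mul {K : Set X} {v w : Param → X → ℂ} {a b : ℝ} (hv : SupBigO K v a)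
    (hw : SupBigO K w b) : SupBigO K (v * w) (a + b) := by
  obtain ⟨C, hC⟩ := hv
  obtain ⟨D, hD⟩ := hw
  refine ⟨C * D, (hC.and hD).mono fun ε hε p hp => ?_⟩
  have h1 := hε.1 p hp
  rw [Real.rpow_add ε.2.1]
  calc ‖(v * w) ε p‖ = ‖v ε p‖ * ‖w ε p‖ := by simp
    _ ≤ (C * (ε : ℝ) ^ a) * (D * (ε : ℝ) ^ b) :=
        mul_le_mul h1 (hε.2 p hp) (norm_nonneg _) ((norm_nonneg _).trans h1)
    _ = _ := by ring

theorem SupBigO.of_isBigO {K : Set X} {z : Param → ℂ} {b : ℝ}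
    (h : z =O[toZero] fun ε : Param => (ε : ℝ) ^ b) : SupBigO K (fun ε _ => z ε) b := by
  obtain ⟨C, hC⟩ := h.bound
  refine ⟨C, hC.mono fun ε hε p _ => ?_⟩
  rwa [Real.norm_of_nonneg (Real.rpow_nonneg ε.2.1.le _)] at hε

end SupBigO

section Smooth

variable {E : Type*} [NormedAddCommGroup E] [NormedSpace ℝ E]
  {X : Type*} [TopologicalSpace X] [ChartedSpace E X]

variable (E) in
/-- Smooth complex-valued functions on `X`. -/
def IsSmooth (f : X → ℂ) : Prop := ContMDiff 𝓘(ℝ, E) 𝓘(ℝ, ℂ) ∞ f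

theorem isSmooth_const (c : ℂ) : IsSmooth E (fun _ : X => c) := contMDiff_const

theorem IsSmooth.add {f g : X → ℂ} (hf : IsSmooth E f) (hg : IsSmooth E g) : IsSmooth E (f + g) :=
  ContMDiff.add hf hg

theorem IsSmooth.neg {f : X → ℂ} (hf : IsSmooth E f) : IsSmooth E (-f) :=
  ContMDiff.neg hf

theorem IsSmooth.mul {f g : X → ℂ} (hf : IsSmooth E f) (hg : IsSmooth E g) : IsSmooth E (f * g) :=
  (contDiff_mul (𝕜 := ℝ) (𝔸 := ℂ)).contMDiff.comp (hf.prodMk_space hg)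

theorem IsSmooth.mdifferentiableAt {f : X → ℂ} (hf : IsSmooth E f) (p : X) :
    MDifferentiableAt 𝓘(ℝ, E) 𝓘(ℝ, ℂ) f p :=
  (ContMDiff.mdifferentiable hf (by simp)) p

end Smooth

section Manifold

variable (E : Type*) [NormedAddCommGroup E] [NormedSpace ℝ E]
  (X : Type*) [TopologicalSpace X] [ChartedSpace E X] [IsManifold 𝓘(ℝ, E) ∞ X]

/-- The smooth vector fields on `X`. -/
abbrev VectorField : Type _ :=
  ContMDiffSection 𝓘(ℝ, E) E ∞ (TangentSpace 𝓘(ℝ, E) : X → Type _)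

variable {E X}

/-- The Lie derivative `L_ξ f` of a complex-valued function along a vector field. -/
noncomputable def lieDeriv (ξ : VectorField E X) (f : X → ℂ) : X → ℂ :=
  fun p => mfderiv 𝓘(ℝ, E) 𝓘(ℝ, ℂ) f p (ξ p)

/-- The iterated Lie derivative `L_{ξ₁} ⋯ L_{ξₖ} f` for a list `[ξ₁, …, ξₖ]` of vector fields. -/
noncomputable def iterLieDeriv (ξs : List (VectorField E X)) (f : X → ℂ) : X → ℂ :=
  ξs.foldr lieDeriv f

variable (E) in
/-- Moderate nets of smooth functions on `X`. -/
def IsModerateNet (u : Param → X → ℂ) : Prop :=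
  (∀ ε, IsSmooth E (u ε)) ∧
    ∀ K : Set X, IsCompact K → ∀ k : ℕ, ∃ b : ℝ, ∀ ξs : List (VectorField E X), ξs.length = k →
      SupBigO K (fun ε => iterLieDeriv ξs (u ε)) b

/-- The estimates on nets that define the negligible nets among the moderate ones. -/
def IsNegligibleNet (u : Param → X → ℂ) : Prop :=
  ∀ K : Set X, IsCompact K → ∀ b : ℝ, SupBigO K u b

theorem IsSmooth.lieDeriv (ξ : VectorField E X) {f : X → ℂ} (hf : IsSmooth E f) :
    IsSmooth E (lieDeriv ξ f) := by
  have h1 : ContMDiff 𝓘(ℝ, E) 𝓘(ℝ, ℂ).tangent ∞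
      (fun p => tangentMap 𝓘(ℝ, E) 𝓘(ℝ, ℂ) f (TotalSpace.mk' E p (ξ p))) :=
    (ContMDiff.contMDiff_tangentMap hf (by simp)).comp ξ.contMDiff
  exact (contMDiff_snd_tangentBundle_modelSpace ℂ 𝓘(ℝ, ℂ)).comp h1

theorem IsSmooth.iterLieDeriv (ξs : List (VectorField E X)) {f : X → ℂ} (hf : IsSmooth E f) :
    IsSmooth E (iterLieDeriv ξs f) := by
  induction ξs with
  | nil => exact hf
  | cons ξ ξs ih => exact ih.lieDeriv ξ

theorem lieDeriv_const (ξ : VectorField E X) (c : ℂ) :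
    lieDeriv ξ (fun _ : X => c) = fun _ => 0 := by
  funext p
  simp only [lieDeriv, mfderiv_const]
  rfl

theorem lieDeriv_add (ξ : VectorField E X) {f g : X → ℂ} (hf : IsSmooth E f) (hg : IsSmooth E g) :
    lieDeriv ξ (f + g) = lieDeriv ξ f + lieDeriv ξ g := by
  funext p
  simp only [lieDeriv, Pi.add_apply]
  rw [mfderiv_add (hf.mdifferentiableAt p) (hg.mdifferentiableAt p)]
  rfl

theorem lieDeriv_neg (ξ : VectorField E X) (f : X → ℂ) :
    lieDeriv ξ (-f) = -lieDeriv ξ f := by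
  funext p
  simp only [lieDeriv, Pi.neg_apply]
  rw [mfderiv_neg]
  rfl

theorem lieDeriv_mul (ξ : VectorField E X) {f g : X → ℂ} (hf : IsSmooth E f) (hg : IsSmooth E g) :
    lieDeriv ξ (f * g) = lieDeriv ξ f * g + f * lieDeriv ξ g := by
  funext p
  have h := ((hf.mdifferentiableAt p).hasMFDerivAt.mul (hg.mdifferentiableAt p).hasMFDerivAt).mfderiv
  simp only [lieDeriv, Pi.mul_apply, Pi.add_apply]
  rw [h]
  exact (add_comm _ _).trans (congrArg₂ (· + ·) (mul_comm (g p) _) rfl)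

theorem iterLieDeriv_add (ξs : List (VectorField E X)) {f g : X → ℂ} (hf : IsSmooth E f)
    (hg : IsSmooth E g) :
    iterLieDeriv ξs (f + g) = iterLieDeriv ξs f + iterLieDeriv ξs g := by
  induction ξs with
  | nil => rfl
  | cons ξ ξs ih =>
    change lieDeriv ξ (iterLieDeriv ξs (f + g)) = _
    rw [ih, lieDeriv_add ξ (hf.iterLieDeriv ξs) (hg.iterLieDeriv ξs)]
    rfl

theorem iterLieDeriv_neg (ξs : List (VectorField E X)) (f : X → ℂ) :
    iterLieDeriv ξs (-f) = -iterLieDeriv ξs f := by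
  induction ξs with
  | nil => rfl
  | cons ξ ξs ih =>
    change lieDeriv ξ (iterLieDeriv ξs (-f)) = _
    rw [ih, lieDeriv_neg]
    rfl

theorem iterLieDeriv_const (ξ : VectorField E X) (ξs : List (VectorField E X)) (c : ℂ) :
    iterLieDeriv (ξ :: ξs) (fun _ : X => c) = fun _ => 0 := by
  induction ξs generalizing ξ with
  | nil => exact lieDeriv_const ξ c
  | cons η ξs ih =>
    change lieDeriv ξ (iterLieDeriv (η :: ξs) _) = _
    rw [ih, lieDeriv_const]

theorem iterLieDeriv_concat (ξ : VectorField E X) (ξs : List (VectorField E X)) (f : X → ℂ) :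
    iterLieDeriv (ξs ++ [ξ]) f = iterLieDeriv ξs (lieDeriv ξ f) := by
  simp [iterLieDeriv]

/-- A common exponent for all derivatives up to order `k`. -/
theorem IsModerateNet.exists_le {u : Param → X → ℂ} (hu : IsModerateNet E u) {K : Set X}
    (hK : IsCompact K) (k : ℕ) : ∃ b : ℝ, ∀ ξs : List (VectorField E X), ξs.length ≤ k →
      SupBigO K (fun ε => iterLieDeriv ξs (u ε)) b := by
  induction k with
  | zero =>
    obtain ⟨b, hb⟩ := hu.2 K hK 0
    exact ⟨b, fun ξs h => hb ξs (Nat.le_zero.mp h)⟩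
  | succ k ih =>
    obtain ⟨b, hb⟩ := hu.2 K hK (k + 1)
    obtain ⟨a, ha⟩ := ih
    refine ⟨min a b, fun ξs h => ?_⟩
    rcases Nat.le_succ_iff.mp h with h | h
    · exact (ha ξs h).mono (min_le_left _ _)
    · exact (hb ξs h).mono (min_le_right _ _)

theorem supBigO_iterLieDeriv_mul {K : Set X} {a b : ℝ} (ξs : List (VectorField E X))
    {u v : Param → X → ℂ} (hu : ∀ ε, IsSmooth E (u ε)) (hv : ∀ ε, IsSmooth E (v ε))
    (hua : ∀ ηs : List (VectorField E X), ηs.length ≤ ξs.length →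
      SupBigO K (fun ε => iterLieDeriv ηs (u ε)) a)
    (hvb : ∀ ηs : List (VectorField E X), ηs.length ≤ ξs.length →
      SupBigO K (fun ε => iterLieDeriv ηs (v ε)) b) :
    SupBigO K (fun ε => iterLieDeriv ξs (u ε * v ε)) (a + b) := by
  induction ξs using List.reverseRecOn generalizing u v with
  | nil => exact (hua [] le_rfl).mul (hvb [] le_rfl)
  | append_singleton ξs ξ ih =>
    have e : (fun ε => iterLieDeriv (ξs ++ [ξ]) (u ε * v ε)) =
        (fun ε => iterLieDeriv ξs (lieDeriv ξ (u ε) * v ε)) +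
          fun ε => iterLieDeriv ξs (u ε * lieDeriv ξ (v ε)) := by
      funext ε
      rw [iterLieDeriv_concat, lieDeriv_mul ξ (hu ε) (hv ε), iterLieDeriv_add ξs
        (((hu ε).lieDeriv ξ).mul (hv ε)) ((hu ε).mul ((hv ε).lieDeriv ξ))]
      rfl
    rw [e]
    simp only [List.length_append, List.length_singleton] at hua hvb
    refine SupBigO.add (ih (fun ε => (hu ε).lieDeriv ξ) hv (fun ηs h => ?_)
      (fun ηs h => hvb ηs (by lia))) (ih hu (fun ε => (hv ε).lieDeriv ξ)
      (fun ηs h => hua ηs (by lia)) (fun ηs h => ?_))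
    · simpa only [iterLieDeriv_concat] using hua (ηs ++ [ξ]) (by simpa using h)
    · simpa only [iterLieDeriv_concat] using hvb (ηs ++ [ξ]) (by simpa using h)

/-- Moderate nets of numbers are moderate as nets of constant functions. -/
theorem isModerateNet_const {z : Param → ℂ} (hz : IsModerate z) :
    IsModerateNet E (fun ε (_ : X) => z ε) := by
  obtain ⟨b, hb⟩ := hz
  refine ⟨fun ε => isSmooth_const _, fun K _ k => ⟨b, fun ξs _ => ?_⟩⟩
  cases ξs with
  | nil => exact SupBigO.of_isBigO hb
  | cons ξ ξs =>
    simp only [iterLieDeriv_const]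
    exact SupBigO.of_isBigO (isBigO_zero _ _)

variable (E X) in
/-- The ring of moderate nets of smooth functions on `X`. -/
def moderateFunNets : Subring (Param → X → ℂ) where
  carrier := {u | IsModerateNet E u}
  mul_mem' := by
    intro u v hu hv
    refine ⟨fun ε => (hu.1 ε).mul (hv.1 ε), fun K hK k => ?_⟩
    obtain ⟨a, ha⟩ := hu.exists_le hK k
    obtain ⟨b, hb⟩ := hv.exists_le hK k
    exact ⟨a + b, fun ξs h => supBigO_iterLieDeriv_mul ξs hu.1 hv.1
      (fun ηs h' => ha ηs (h'.trans h.le)) (fun ηs h' => hb ηs (h'.trans h.le))⟩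
  one_mem' := isModerateNet_const (isModerate_const 1)
  add_mem' := by
    intro u v hu hv
    refine ⟨fun ε => (hu.1 ε).add (hv.1 ε), fun K hK k => ?_⟩
    obtain ⟨a, ha⟩ := hu.2 K hK k
    obtain ⟨b, hb⟩ := hv.2 K hK k
    refine ⟨min a b, fun ξs h => ?_⟩
    have e : (fun ε => iterLieDeriv ξs ((u + v) ε)) =
        (fun ε => iterLieDeriv ξs (u ε)) + fun ε => iterLieDeriv ξs (v ε) :=
      funext fun ε => iterLieDeriv_add ξs (hu.1 ε) (hv.1 ε)
    rw [e]
    exact ((ha ξs h).mono (min_le_left _ _)).add ((hb ξs h).mono (min_le_right _ _))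
  zero_mem' := isModerateNet_const (isModerate_const 0)
  neg_mem' := by
    intro u hu
    refine ⟨fun ε => (hu.1 ε).neg, fun K hK k => ?_⟩
    obtain ⟨a, ha⟩ := hu.2 K hK k
    refine ⟨a, fun ξs h => ?_⟩
    have e : (fun ε => iterLieDeriv ξs ((-u) ε)) = -fun ε => iterLieDeriv ξs (u ε) :=
      funext fun ε => iterLieDeriv_neg ξs (u ε)
    rw [e]
    exact (ha ξs h).neg

variable (E X) in
/-- The ideal of negligible nets in the ring of moderate nets of smooth functions on `X`. -/
def negligibleFunNets : Ideal (moderateFunNets E X) where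
  carrier := {u | IsNegligibleNet u.1}
  add_mem' := fun hu hv K hK b => (hu K hK b).add (hv K hK b)
  zero_mem' := fun _ _ _ => SupBigO.of_isBigO (z := 0) (isBigO_zero _ _)
  smul_mem' := by
    rintro ⟨u, hu⟩ v hv K hK b
    obtain ⟨a, ha⟩ := hu.2 K hK 0
    have h := (ha [] rfl).mul (hv K hK (b - a))
    rw [add_sub_cancel] at h
    exact h

variable (E X) in
/-- The (special) Colombeau algebra `𝒢(X)` of generalized functions on the manifold `X`. -/
def GenFun : Type _ := moderateFunNets E X ⧸ negligibleFunNets E X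

noncomputable instance : CommRing (GenFun E X) :=
  inferInstanceAs (CommRing (moderateFunNets E X ⧸ negligibleFunNets E X))

variable (E X) in
/-- The generalized function represented by a moderate net. -/
noncomputable def GenFun.mk : moderateFunNets E X →+* GenFun E X :=
  Ideal.Quotient.mk (negligibleFunNets E X)

variable (E X) in
/-- Moderate nets of numbers, regarded as nets of constant functions. -/
def constNets : moderateNets →+* moderateFunNets E X where
  toFun z := ⟨fun ε _ => z.1 ε, isModerateNet_const z.2⟩
  map_one' := rfl
  map_mul' _ _ := rfl
  map_zero' := rfl
  map_add' _ _ := rfl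

variable (E X) in
/-- Generalized numbers as constant generalized functions. -/
noncomputable def GenFun.const : GenNumber →+* GenFun E X :=
  Ideal.quotientMap (negligibleFunNets E X) (constNets E X) fun z hz _ _ b =>
    SupBigO.of_isBigO (z := z.1) (hz b)

/-- `𝒢(X)` is an algebra over the ring of generalized numbers. -/
noncomputable instance : Algebra GenNumber (GenFun E X) := (GenFun.const E X).toAlgebra

end Manifold

theorem isVonNBounded_of_pos (E : Type*) [NormedAddCommGroup E] [NormedSpace ℝ E]
    [FiniteDimensional ℝ E]
    (g : E →L[ℝ] E →L[ℝ] ℝ) (hg : ∀ v, v ≠ 0 → 0 < g v v) :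
    Bornology.IsVonNBounded ℝ {v : E | g v v < 1} := by
  have : ProperSpace E := FiniteDimensional.proper ℝ E
  rw [NormedSpace.isVonNBounded_iff]
  obtain ⟨c, hc, h⟩ : ∃ c > 0, ∀ v : E, c * ‖v‖ ^ 2 ≤ g v v := by
    have hcont : Continuous fun v : E => g v v := g.continuous.clm_apply continuous_id
    rcases (Metric.sphere (0 : E) 1).eq_empty_or_nonempty with he | hne
    · refine ⟨1, one_pos, fun v => ?_⟩
      by_cases hv : v = 0
      · simp [hv]
      · exfalso
        have : ‖v‖⁻¹ • v ∈ Metric.sphere (0 : E) 1 := by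
          simp [norm_smul, norm_ne_zero_iff.mpr hv]
        simp [he] at this
    · obtain ⟨w, hw, hmin⟩ := (isCompact_sphere (0 : E) 1).exists_isMinOn hne hcont.continuousOn
      have hw0 : w ≠ 0 := by
        rintro rfl
        simp at hw
      refine ⟨g w w, hg w hw0, fun v => ?_⟩
      by_cases hv : v = 0
      · simp [hv]
      · have hv' : ‖v‖ ≠ 0 := norm_ne_zero_iff.mpr hv
        have hmem : ‖v‖⁻¹ • v ∈ Metric.sphere (0 : E) 1 := by
          simp [norm_smul, hv']
        have h1 : g w w ≤ g (‖v‖⁻¹ • v) (‖v‖⁻¹ • v) := hmin hmem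
        have h2 : g (‖v‖⁻¹ • v) (‖v‖⁻¹ • v) = g v v / ‖v‖ ^ 2 := by
          simp
          field_simp
        rw [h2, le_div_iff₀ (by positivity)] at h1
        exact h1
  refine (Metric.isBounded_closedBall (x := (0 : E)) (r := Real.sqrt (1 / c))).subset fun v hv => ?_
  rw [mem_closedBall_zero_iff]
  apply Real.le_sqrt_of_sq_le
  rw [le_div_iff₀ hc, mul_comm]
  exact (h v).trans (le_of_lt hv)

section Metric

variable (E : Type*) [NormedAddCommGroup E] [NormedSpace ℝ E]
  (X : Type*) [TopologicalSpace X] [ChartedSpace E X] [IsManifold 𝓘(ℝ, E) ∞ X]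

/-- The smooth Riemannian metrics on `X`. -/
abbrev RiemMetric : Type _ :=
  ContMDiffRiemannianMetric 𝓘(ℝ, E) ∞ E (TangentSpace 𝓘(ℝ, E) : X → Type _)

set_option maxHeartbeats 1600000 in
set_option synthInstance.maxHeartbeats 400000 in
/-- Every smooth manifold carries a smooth Riemannian metric. -/
theorem nonempty_riemMetric [FiniteDimensional ℝ E] [T2Space X] [SecondCountableTopology X] :
    Nonempty (RiemMetric E X) := by
  have : LocallyCompactSpace X := ChartedSpace.locallyCompactSpace E X
  let V : X → Type _ := fun x => TangentSpace 𝓘(ℝ, E) x →L[ℝ] TangentSpace 𝓘(ℝ, E) x →L[ℝ] ℝ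
  let t : ∀ x : X, Set (V x) := fun x =>
    {g | (∀ v w, g v w = g w v) ∧ ∀ v, v ≠ 0 → 0 < g v v}
  have ht : ∀ x, Convex ℝ (t x) := by
    intro x
    rw [convex_iff_forall_pos]
    intro g hg g' hg' a b ha hb _
    refine ⟨fun v w => ?_, fun v hv => ?_⟩
    · change a * g v w + b * g' v w = a * g w v + b * g' w v
      rw [hg.1 v w, hg'.1 v w]
    · change 0 < a * g v v + b * g' v v
      have := hg.2 v hv
      have := hg'.2 v hv
      positivity
  let T : E →L[ℝ] EuclideanSpace ℝ (Fin (Module.finrank ℝ E)) :=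
    (toEuclidean (E := E)).toContinuousLinearMap
  let b₀ : E →L[ℝ] E →L[ℝ] ℝ := (ContinuousLinearMap.precomp ℝ T) ∘L (innerSL ℝ) ∘L T
  have hb₀ : ∀ v w, b₀ v w = inner ℝ (toEuclidean v) (toEuclidean w) := fun v w => rfl
  obtain ⟨s, hs⟩ := exists_contMDiffSection_forall_mem_convex_of_local 𝓘(ℝ, E) (n := ⊤)
    (F_fiber := E →L[ℝ] E →L[ℝ] ℝ) V t ht (by
      intro x₀
      let e := trivializationAt E (TangentSpace 𝓘(ℝ, E) : X → Type _) x₀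
      let e' := trivializationAt (E →L[ℝ] E →L[ℝ] ℝ) V x₀
      let L : ∀ y : X, TangentSpace 𝓘(ℝ, E) y →L[ℝ] E := fun y => e.continuousLinearMapAt ℝ y
      have hbase : ∀ y ∈ e'.baseSet, y ∈ e.baseSet := fun y hy => hy.1
      refine ⟨e'.baseSet, e'.open_baseSet.mem_nhds (FiberBundle.mem_baseSet_trivializationAt' x₀),
        fun y => (ContinuousLinearMap.precomp ℝ (L y)) ∘L b₀ ∘L (L y), ?_, ?_⟩
      · have : MemTrivializationAtlas e' := inferInstanceAs
          (MemTrivializationAtlas (trivializationAt (E →L[ℝ] E →L[ℝ] ℝ) V x₀))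
        refine (Trivialization.contMDiffOn_section_baseSet_iff (𝕜 := ℝ) (IB := 𝓘(ℝ, E)) (n := ∞)
          (F := E →L[ℝ] E →L[ℝ] ℝ) (E := V) e').2 ?_
        refine (contMDiffOn_const (c := b₀)).congr fun y hy => ?_
        ext v w
        have h := inCoordinates_apply_eq₂ (𝕜 := ℝ) (x₀ := x₀) (x := y)
          (E₁ := (TangentSpace 𝓘(ℝ, E) : X → Type _)) (F₁ := E)
          (E₂ := (TangentSpace 𝓘(ℝ, E) : X → Type _)) (F₂ := E)
          (E₃ := fun _ => ℝ) (F₃ := ℝ)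
          (ϕ := (ContinuousLinearMap.precomp ℝ (L y)) ∘L b₀ ∘L (L y)) (v := v) (w := w)
          (hbase y hy) (hbase y hy) (Set.mem_univ _)
        refine h.trans ?_
        have h1 : ∀ v : E, L y (e.symm y v) = v := fun v =>
          (e.continuousLinearMapAt_apply_of_mem ℝ (hbase y hy) _).trans
            (by rw [e.apply_mk_symm (hbase y hy)])
        have h2 : ∀ r : ℝ, Trivialization.linearMapAt ℝ
            (trivializationAt ℝ (fun _ : X => ℝ) x₀) y r = r := fun r => by
          rw [Trivialization.linearMapAt_apply]
          exact if_pos (Set.mem_univ y)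
        refine (h2 _).trans ?_
        change b₀ (L y (e.symm y v)) (L y (e.symm y w)) = b₀ v w
        rw [h1, h1]
      · intro y hy
        refine ⟨fun v w => ?_, fun v hv => ?_⟩
        · change b₀ (L y v) (L y w) = b₀ (L y w) (L y v)
          rw [hb₀, hb₀, real_inner_comm]
        · change 0 < b₀ (L y v) (L y v)
          rw [hb₀, real_inner_self_pos]
          intro h0
          have h1 : L y v = 0 := by simpa using h0
          apply hv
          have h2 := e.symmL_continuousLinearMapAt (R := ℝ) (hbase y hy) v
          rw [← h2]
          change e.symmL ℝ y (L y v) = 0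
          rw [h1, map_zero])
  exact ⟨{
    inner := s
    symm := fun x => (hs x).1
    pos := fun x => (hs x).2
    isVonNBounded := fun x => isVonNBounded_of_pos E (s x) (hs x).2
    contMDiff := s.contMDiff }⟩
end Metric

section Riemannian

variable {E : Type*} [NormedAddCommGroup E] [NormedSpace ℝ E]
  {X : Type*} [TopologicalSpace X] [ChartedSpace E X]
  [RiemannianBundle (TangentSpace 𝓘(ℝ, E) : X → Type _)]

theorem norm_sub_le_of_riemannianEDist [IsManifold 𝓘(ℝ, E) 1 X]
    {f : X → ℂ} (hf : ContMDiff 𝓘(ℝ, E) 𝓘(ℝ, ℂ) 1 f)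
    {L : ∀ y : X, TangentSpace 𝓘(ℝ, E) y →L[ℝ] ℂ}
    (hL : ∀ y, L y = mfderiv 𝓘(ℝ, E) 𝓘(ℝ, ℂ) f y) {M : NNReal} {x z : X} {r : ENNReal}
    (hM : ∀ y, Manifold.riemannianEDist 𝓘(ℝ, E) x y < r → ∀ v : TangentSpace 𝓘(ℝ, E) y,
      ‖L y v‖ₑ ≤ M * ‖v‖ₑ)
    (hz : Manifold.riemannianEDist 𝓘(ℝ, E) x z < r) :
    ‖f z - f x‖ₑ ≤ M * r := by
  obtain ⟨γ, hγ0, hγ1, hγ, hlen⟩ := Manifold.exists_lt_of_riemannianEDist_lt hz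
  have hstay : ∀ t ∈ Set.Icc (0 : ℝ) 1, Manifold.riemannianEDist 𝓘(ℝ, E) x (γ t) < r := by
    intro t ht
    refine lt_of_le_of_lt ?_ hlen
    refine (Manifold.riemannianEDist_le_pathELength (hγ.mono (Set.Icc_subset_Icc le_rfl ht.2))
      hγ0 rfl ht.1).trans (Manifold.pathELength_mono le_rfl ht.2)
  have hfγ : ContMDiffOn 𝓘(ℝ, ℝ) 𝓘(ℝ, ℂ) 1 (f ∘ γ) (Set.Icc 0 1) := hf.comp_contMDiffOn hγ
  calc
    ‖f z - f x‖ₑ = ‖(f ∘ γ) 1 - (f ∘ γ) 0‖ₑ := by simp [hγ0, hγ1]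
    _ ≤ ∫⁻ t in Set.Icc (0 : ℝ) 1, ‖derivWithin (f ∘ γ) (Set.Icc 0 1) t‖ₑ := by
      apply enorm_sub_le_lintegral_derivWithin_Icc_of_contDiffOn_Icc _ zero_le_one
      rwa [← contMDiffOn_iff_contDiffOn]
    _ ≤ ∫⁻ t in Set.Icc (0 : ℝ) 1, M * ‖mfderivWithin 𝓘(ℝ, ℝ) 𝓘(ℝ, E) γ (Set.Icc 0 1) t 1‖ₑ := by
      apply MeasureTheory.setLIntegral_mono' measurableSet_Icc (fun t ht => ?_)
      have h1 : mfderivWithin 𝓘(ℝ, ℝ) 𝓘(ℝ, ℂ) (f ∘ γ) (Set.Icc 0 1) t =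
          (mfderiv 𝓘(ℝ, E) 𝓘(ℝ, ℂ) f (γ t)) ∘L
            (mfderivWithin 𝓘(ℝ, ℝ) 𝓘(ℝ, E) γ (Set.Icc 0 1) t) := by
        apply mfderiv_comp_mfderivWithin
        · exact hf.mdifferentiable one_ne_zero _
        · exact hγ.mdifferentiableOn one_ne_zero t ht
        · rw [uniqueMDiffWithinAt_iff_uniqueDiffWithinAt]
          exact uniqueDiffOn_Icc zero_lt_one t ht
      have h2 : derivWithin (f ∘ γ) (Set.Icc 0 1) t =
          L (γ t) (mfderivWithin 𝓘(ℝ, ℝ) 𝓘(ℝ, E) γ (Set.Icc 0 1) t 1) := by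
        rw [hL, ← fderivWithin_derivWithin, ← mfderivWithin_eq_fderivWithin]
        exact congr($h1 (1 : ℝ))
      rw [h2]
      exact hM _ (hstay t ht) _
    _ = M * Manifold.pathELength 𝓘(ℝ, E) γ 0 1 := by
      rw [MeasureTheory.lintegral_const_mul' _ _ ENNReal.coe_ne_top,
        Manifold.pathELength_eq_lintegral_mfderivWithin_Icc]
    _ ≤ M * r := by gcongr

theorem exists_compact_riemannianEDist [IsManifold 𝓘(ℝ, E) 1 X]
    [IsContinuousRiemannianBundle E (TangentSpace 𝓘(ℝ, E) : X → Type _)]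
    [FiniteDimensional ℝ E] [T2Space X] {K : Set X} (hK : IsCompact K) :
    ∃ K' : Set X, IsCompact K' ∧ ∃ r : ℝ, 0 < r ∧
      ∀ x ∈ K, ∀ y, Manifold.riemannianEDist 𝓘(ℝ, E) x y < ENNReal.ofReal r → y ∈ K' := by
  have : LocallyCompactSpace X := ChartedSpace.locallyCompactSpace E X
  obtain ⟨K', hK', hKK'⟩ := exists_compact_superset hK
  let : PseudoEMetricSpace X := PseudoEMetricSpace.ofRiemannianMetric 𝓘(ℝ, E) X
  obtain ⟨r, hr, h⟩ := hK.exists_thickening_subset_open isOpen_interior hKK'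
  refine ⟨K', hK', r, hr, fun x hx y hy => interior_subset (h ?_)⟩
  rw [Metric.mem_thickening_iff_exists_edist_lt]
  refine ⟨x, hx, ?_⟩
  change Manifold.riemannianEDist 𝓘(ℝ, E) y x < _
  rwa [Manifold.riemannianEDist_comm]

theorem exists_local_frame_bound [IsManifold 𝓘(ℝ, E) ∞ X]
    [IsContinuousRiemannianBundle E (TangentSpace 𝓘(ℝ, E) : X → Type _)]
    [FiniteDimensional ℝ E] [T2Space X] (x : X) :
    ∃ S : Set (VectorField E X), S.Finite ∧ ∃ C : ℝ, 0 ≤ C ∧ ∀ᶠ y in 𝓝 x,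
      ∀ (g : TangentSpace 𝓘(ℝ, E) y →L[ℝ] ℂ) (m : ℝ), (∀ ξ ∈ S, ‖g (ξ y)‖ ≤ m) → 0 ≤ m →
        ∀ v, ‖g v‖ ≤ C * m * ‖v‖ := by
  let e := trivializationAt E (TangentSpace 𝓘(ℝ, E) : X → Type _) x
  have hx : x ∈ e.baseSet := FiberBundle.mem_baseSet_trivializationAt' x
  let b := Module.finBasis ℝ E
  obtain ⟨ψ, hψ⟩ : ∃ ψ : SmoothBumpFunction 𝓘(ℝ, E) x, tsupport ψ ⊆ e.baseSet := by
    obtain ⟨ψ, -, hψ⟩ := (SmoothBumpFunction.nhds_basis_tsupport (I := 𝓘(ℝ, E)) x).mem_iff.1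
      (e.open_baseSet.mem_nhds hx)
    exact ⟨ψ, hψ⟩
  let ξ : Fin (Module.finrank ℝ E) → VectorField E X := fun i =>
    ⟨(ψ : X → ℝ) • e.localFrame b i, ContMDiffOn.smul_section_of_tsupport
      (ψ.contMDiff.contMDiffOn) e.open_baseSet hψ (e.contMDiffOn_localFrame_baseSet (n := ∞) b i)⟩
  obtain ⟨C, hC, hCe⟩ := eventually_norm_trivializationAt_lt E
    (TangentSpace 𝓘(ℝ, E) : X → Type _) x
  let D : ℝ := ∑ i, ‖(LinearMap.toContinuousLinearMap (b.coord i))‖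
  refine ⟨Set.range ξ, Set.finite_range ξ, D * C, by positivity, ?_⟩
  filter_upwards [hCe, e.open_baseSet.mem_nhds hx, ψ.eventuallyEq_one] with y hy hyb hψy g m hm hm0 v
  let L := e.continuousLinearMapAt ℝ y
  have hξ : ∀ i, ξ i y = e.symmL ℝ y (b i) := by
    intro i
    change (ψ y : ℝ) • e.localFrame b i y = _
    rw [show ψ y = 1 from hψy, one_smul, e.localFrame_apply_of_mem_baseSet b hyb]
    simp only [Trivialization.basisAt, Module.Basis.map_apply]
    exact (e.symmL_apply hyb _).symm
  have hv : v = ∑ i, b.coord i (L v) • ξ i y := by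
    have h1 : e.symmL ℝ y (L v) = v := e.symmL_continuousLinearMapAt (R := ℝ) hyb v
    conv_lhs => rw [← h1, ← b.sum_repr (L v), map_sum]
    refine Finset.sum_congr rfl fun i _ => ?_
    rw [map_smul, hξ]
    rfl
  have hLv : ‖L v‖ ≤ C * ‖v‖ := (L.le_opNorm v).trans (by gcongr)
  calc ‖g v‖ = ‖∑ i, b.coord i (L v) • g (ξ i y)‖ := by
        conv_lhs => rw [hv, map_sum]
        simp only [map_smul]
    _ ≤ ∑ i, ‖b.coord i (L v) • g (ξ i y)‖ := norm_sum_le _ _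
    _ ≤ ∑ i, (‖(LinearMap.toContinuousLinearMap (b.coord i))‖ * (C * ‖v‖)) * m := by
        refine Finset.sum_le_sum fun i _ => ?_
        rw [norm_smul]
        have h2 : ‖b.coord i (L v)‖ ≤ ‖(LinearMap.toContinuousLinearMap (b.coord i))‖ * ‖L v‖ :=
          (LinearMap.toContinuousLinearMap (b.coord i)).le_opNorm (L v)
        have h3 : ‖g (ξ i y)‖ ≤ m := hm _ (Set.mem_range_self i)
        have h4 : ‖b.coord i (L v)‖ ≤
            ‖(LinearMap.toContinuousLinearMap (b.coord i))‖ * (C * ‖v‖) :=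
          h2.trans (by gcongr)
        gcongr
    _ = D * C * m * ‖v‖ := by
        rw [← Finset.sum_mul, ← Finset.sum_mul]
        ring

theorem exists_frame_bound [IsManifold 𝓘(ℝ, E) ∞ X]
    [IsContinuousRiemannianBundle E (TangentSpace 𝓘(ℝ, E) : X → Type _)]
    [FiniteDimensional ℝ E] [T2Space X] {K : Set X} (hK : IsCompact K) :
    ∃ S : Set (VectorField E X), S.Finite ∧ ∃ C : ℝ, 0 ≤ C ∧ ∀ y ∈ K,
      ∀ (g : TangentSpace 𝓘(ℝ, E) y →L[ℝ] ℂ) (m : ℝ), (∀ ξ ∈ S, ‖g (ξ y)‖ ≤ m) → 0 ≤ m →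
        ∀ v, ‖g v‖ ≤ C * m * ‖v‖ := by
  refine hK.induction_on (p := fun K => ∃ S : Set (VectorField E X), S.Finite ∧ ∃ C : ℝ, 0 ≤ C ∧
    ∀ y ∈ K, ∀ (g : TangentSpace 𝓘(ℝ, E) y →L[ℝ] ℂ) (m : ℝ), (∀ ξ ∈ S, ‖g (ξ y)‖ ≤ m) → 0 ≤ m →
        ∀ v, ‖g v‖ ≤ C * m * ‖v‖) ?_ ?_ ?_ ?_
  · exact ⟨∅, Set.finite_empty, 0, le_rfl, fun y hy => hy.elim⟩
  · rintro s t hst ⟨S, hS, C, hC, h⟩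
    exact ⟨S, hS, C, hC, fun y hy => h y (hst hy)⟩
  · rintro s t ⟨S, hS, C, hC, h⟩ ⟨S', hS', C', hC', h'⟩
    refine ⟨S ∪ S', hS.union hS', max C C', le_max_of_le_left hC, ?_⟩
    rintro y (hy | hy) g m hm hm0 v
    · refine (h y hy g m (fun ξ hξ => hm ξ (Or.inl hξ)) hm0 v).trans ?_
      gcongr
      exact le_max_left _ _
    · refine (h' y hy g m (fun ξ hξ => hm ξ (Or.inr hξ)) hm0 v).trans ?_
      gcongr
      exact le_max_right _ _
  · intro x _
    obtain ⟨S, hS, C, hC, h⟩ := exists_local_frame_bound (E := E) x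
    exact ⟨_, mem_nhdsWithin_of_mem_nhds h, S, hS, C, hC, fun y hy => hy⟩

end Riemannian

section Points

variable {E : Type*} [NormedAddCommGroup E] [NormedSpace ℝ E]
  {X : Type*} [TopologicalSpace X] [ChartedSpace E X] [IsManifold 𝓘(ℝ, E) ∞ X]

/-- The Riemannian distance `d_h` induced by a Riemannian metric `h`: the infimum of the lengths
of the paths between two points (`∞` if the points lie in different components). -/
noncomputable def riemDist (h : RiemMetric E X) (x y : X) : ENNReal :=
  letI : RiemannianBundle (TangentSpace 𝓘(ℝ, E) : X → Type _) := ⟨h.toRiemannianMetric⟩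
  Manifold.riemannianEDist 𝓘(ℝ, E) x y

theorem riemDist_self (h : RiemMetric E X) (x : X) : riemDist h x x = 0 := by
  let : RiemannianBundle (TangentSpace 𝓘(ℝ, E) : X → Type _) := ⟨h.toRiemannianMetric⟩
  exact Manifold.riemannianEDist_self

theorem riemDist_comm (h : RiemMetric E X) (x y : X) : riemDist h x y = riemDist h y x := by
  let : RiemannianBundle (TangentSpace 𝓘(ℝ, E) : X → Type _) := ⟨h.toRiemannianMetric⟩
  exact Manifold.riemannianEDist_comm

theorem riemDist_triangle (h : RiemMetric E X) (x y z : X) :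
    riemDist h x z ≤ riemDist h x y + riemDist h y z := by
  let : RiemannianBundle (TangentSpace 𝓘(ℝ, E) : X → Type _) := ⟨h.toRiemannianMetric⟩
  exact Manifold.riemannianEDist_triangle

variable (X) in
/-- The compactly supported nets of points of `X`. -/
def PointNet : Type _ :=
  {p : Param → X // ∃ K : Set X, IsCompact K ∧ ∀ᶠ ε in toZero, p ε ∈ K}

/-- The net of Riemannian distances between two nets of points is negligible. -/
def IsNegligibleDist (h : RiemMetric E X) (p q : Param → X) : Prop :=
  ∀ b : ℝ, ∃ C : ℝ, ∀ᶠ ε : Param in toZero, riemDist h (p ε) (q ε) ≤ ENNReal.ofReal (C * (ε : ℝ) ^ b)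

variable (E X) in
/-- Equivalence of compactly supported nets of points: for every Riemannian metric `h` on `X`, the
net of distances `d_h(p_ε, q_ε)` is negligible. (Riemannian metrics exist by `nonempty_riemMetric`, and
the condition does not depend on the choice of `h`.) -/
def pointSetoid : Setoid (PointNet X) where
  r p q := ∀ h : RiemMetric E X, IsNegligibleDist h p.1 q.1
  iseqv := by
    refine ⟨fun p h b => ⟨0, ?_⟩, fun {p q} hpq h b => ?_, fun {p q s} hpq hqs h b => ?_⟩
    · exact Eventually.of_forall fun ε => by simp [riemDist_self]
    · obtain ⟨C, hC⟩ := hpq h b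
      exact ⟨C, hC.mono fun ε hε => by rwa [riemDist_comm]⟩
    · obtain ⟨C, hC⟩ := hpq h b
      obtain ⟨D, hD⟩ := hqs h b
      refine ⟨|C| + |D|, (hC.and hD).mono fun ε hε => ?_⟩
      have h0 := Real.rpow_nonneg ε.2.1.le b
      refine (riemDist_triangle h _ (q.1 ε) _).trans ?_
      rw [add_mul, ENNReal.ofReal_add (by positivity) (by positivity)]
      refine add_le_add (hε.1.trans ?_) (hε.2.trans ?_) <;>
        exact ENNReal.ofReal_le_ofReal (mul_le_mul_of_nonneg_right (le_abs_self _) h0)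

variable (E X) in
/-- The set of compactly supported generalized points on `X`. -/
def GenPoint : Type _ := Quotient (pointSetoid E X)

theorem isModerate_eval (p : PointNet X) {u : Param → X → ℂ} (hu : IsModerateNet E u) :
    IsModerate fun ε => u ε (p.1 ε) := by
  obtain ⟨K, hK, hp⟩ := p.2
  obtain ⟨b, hb⟩ := hu.2 K hK 0
  obtain ⟨C, hC⟩ := hb [] rfl
  refine ⟨b, IsBigO.of_bound C ((hC.and hp).mono fun ε hε => ?_)⟩
  rw [Real.norm_of_nonneg (Real.rpow_nonneg ε.2.1.le b)]
  exact hε.1 _ hε.2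

theorem isNegligible_eval (p : PointNet X) {u : Param → X → ℂ} (hu : IsNegligibleNet u) :
    IsNegligible fun ε => u ε (p.1 ε) := by
  obtain ⟨K, hK, hp⟩ := p.2
  intro b
  obtain ⟨C, hC⟩ := hu K hK b
  refine IsBigO.of_bound C ((hC.and hp).mono fun ε hε => ?_)
  rw [Real.norm_of_nonneg (Real.rpow_nonneg ε.2.1.le b)]
  exact hε.1 _ hε.2

/-- Evaluation of moderate nets of functions along a compactly supported net of points. -/
def evalNets (p : PointNet X) : moderateFunNets E X →+* moderateNets where
  toFun u := ⟨fun ε => u.1 ε (p.1 ε), isModerate_eval p u.2⟩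
  map_one' := rfl
  map_mul' _ _ := rfl
  map_zero' := rfl
  map_add' _ _ := rfl

/-- The evaluation of generalized functions along a compactly supported net of points. -/
noncomputable def evalAtNet (p : PointNet X) : GenFun E X →+* GenNumber :=
  Ideal.quotientMap negligibleNets (evalNets p) fun _ hu => isNegligible_eval p hu

theorem tendsto_toZero : Tendsto (fun ε : Param => (ε : ℝ)) toZero (𝓝 0) := tendsto_comap

theorem IsNegligibleDist.isNegligible_sub [FiniteDimensional ℝ E] [T2Space X] {h : RiemMetric E X}
    {p q : PointNet X} (hpq : IsNegligibleDist h p.1 q.1) {u : Param → X → ℂ}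
    (hu : IsModerateNet E u) : IsNegligible fun ε => u ε (q.1 ε) - u ε (p.1 ε) := by
  let : RiemannianBundle (TangentSpace 𝓘(ℝ, E) : X → Type _) := ⟨h.toRiemannianMetric⟩
  have : IsContinuousRiemannianBundle E (TangentSpace 𝓘(ℝ, E) : X → Type _) :=
    ⟨⟨h.inner, h.contMDiff.continuous, fun _ _ _ => rfl⟩⟩
  obtain ⟨K, hK, hp⟩ := p.2
  obtain ⟨K', hK', r, hr, hrK'⟩ := exists_compact_riemannianEDist (E := E) hK
  obtain ⟨S, hS, C, hC, hSC⟩ := exists_frame_bound (E := E) hK'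
  obtain ⟨a, ha⟩ := hu.2 K' hK' 1
  have hD : ∃ D : ℝ, 0 ≤ D ∧ ∀ᶠ ε : Param in toZero, ∀ ξ ∈ S, ∀ y ∈ K',
      ‖lieDeriv ξ (u ε) y‖ ≤ D * (ε : ℝ) ^ a := by
    have h1 : ∀ ξ : VectorField E X, ∃ D : ℝ, ∀ᶠ ε : Param in toZero, ∀ y ∈ K',
      ‖lieDeriv ξ (u ε) y‖ ≤ D * (ε : ℝ) ^ a := fun ξ => ha [ξ] rfl
    choose D hD using h1
    refine ⟨∑ ξ ∈ hS.toFinset, |D ξ|, by positivity, ?_⟩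
    refine ((eventually_all_finite hS).2 fun ξ _ => hD ξ).mono fun ε hε ξ hξ y hy => ?_
    refine (hε ξ hξ y hy).trans (mul_le_mul_of_nonneg_right ?_ (Real.rpow_nonneg ε.2.1.le a))
    exact (le_abs_self _).trans (Finset.single_le_sum (f := fun ξ => |D ξ|)
      (fun _ _ => abs_nonneg _) (hS.mem_toFinset.2 hξ))
  obtain ⟨D, hD0, hD⟩ := hD
  intro b
  let b' : ℝ := max (b - a) 1
  obtain ⟨A, hA⟩ := hpq b'
  have hsmall : ∀ᶠ ε : Param in toZero, (|A| + 1) * (ε : ℝ) ^ b' ≤ r := by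
    have h1 : Tendsto (fun ε : Param => (|A| + 1) * (ε : ℝ)) toZero (𝓝 0) := by
      simpa using tendsto_toZero.const_mul (|A| + 1)
    filter_upwards [h1.eventually (Iio_mem_nhds hr)] with ε hε
    refine le_trans ?_ (le_of_lt hε)
    gcongr
    simpa using Real.rpow_le_rpow_of_exponent_ge ε.2.1 ε.2.2.le (le_max_right (b - a) 1)
  refine IsBigO.of_bound (C * D * (|A| + 1)) ?_
  filter_upwards [hp, hD, hA, hsmall] with ε hpε hDε hAε hrε
  have hε0 : (0 : ℝ) < ε := ε.2.1
  have hεa := Real.rpow_pos_of_pos hε0 a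
  have hεb' := Real.rpow_pos_of_pos hε0 b'
  let L : ∀ y : X, TangentSpace 𝓘(ℝ, E) y →L[ℝ] ℂ := fun y => mfderiv 𝓘(ℝ, E) 𝓘(ℝ, ℂ) (u ε) y
  have hkey := norm_sub_le_of_riemannianEDist (f := u ε) (x := p.1 ε) (z := q.1 ε)
    (ContMDiff.of_le (hu.1 ε) (by exact_mod_cast le_top)) (L := L) (fun _ => rfl)
    (M := (C * (D * (ε : ℝ) ^ a)).toNNReal)
    (r := ENNReal.ofReal ((|A| + 1) * (ε : ℝ) ^ b'))
    (fun y hy v => by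
      have hy' : y ∈ K' := hrK' _ hpε y (hy.trans_le (ENNReal.ofReal_le_ofReal hrε))
      have h1 := hSC y hy' (L y) (D * (ε : ℝ) ^ a) (fun ξ hξ => hDε ξ hξ y hy') (by positivity) v
      rw [← ofReal_norm, ← ofReal_norm]
      change _ ≤ ENNReal.ofReal _ * _
      rw [← ENNReal.ofReal_mul (by positivity)]
      exact ENNReal.ofReal_le_ofReal h1)
    (by
      refine lt_of_le_of_lt hAε ?_
      rw [ENNReal.ofReal_lt_ofReal_iff (by positivity)]
      gcongr
      linarith [le_abs_self A])
  rw [← ofReal_norm] at hkey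
  change _ ≤ ENNReal.ofReal _ * _ at hkey
  rw [← ENNReal.ofReal_mul (by positivity), ENNReal.ofReal_le_ofReal_iff (by positivity)] at hkey
  refine hkey.trans ?_
  rw [Real.norm_of_nonneg (Real.rpow_nonneg hε0.le b)]
  have h2 : (ε : ℝ) ^ a * (ε : ℝ) ^ b' ≤ (ε : ℝ) ^ b := by
    rw [← Real.rpow_add hε0]
    exact Real.rpow_le_rpow_of_exponent_ge hε0 ε.2.2.le
      (by linarith [le_max_left (b - a) (1 : ℝ)])
  calc C * (D * (ε : ℝ) ^ a) * ((|A| + 1) * (ε : ℝ) ^ b')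
      = C * D * (|A| + 1) * ((ε : ℝ) ^ a * (ε : ℝ) ^ b') := by ring
    _ ≤ C * D * (|A| + 1) * (ε : ℝ) ^ b := by gcongr

variable [FiniteDimensional ℝ E] [T2Space X] [SecondCountableTopology X]

theorem evalAtNet_congr {p q : PointNet X} (hpq : pointSetoid E X p q) (u : GenFun E X) :
    evalAtNet p u = evalAtNet q u := by
  obtain ⟨h⟩ := nonempty_riemMetric E X
  obtain ⟨u, rfl⟩ := Ideal.Quotient.mk_surjective u
  refine (Ideal.Quotient.eq.2 ?_).symm
  exact (hpq h).isNegligible_sub u.2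

/-- The evaluation map `δ_p : 𝒢(X) → ℂ̃`, `δ_p(u) = u(p)`, at a compactly supported generalized
point `p`: if `(u_ε)` represents `u` and `(p_ε)` represents `p`, then `(u_ε(p_ε))` represents
`u(p)`. -/
noncomputable def delta (p : GenPoint E X) (u : GenFun E X) : GenNumber :=
  Quotient.lift (fun p : PointNet X => evalAtNet p u) (fun _ _ h => evalAtNet_congr h u) p

/-- The evaluation map in terms of representatives. -/
theorem delta_mk (p : PointNet X) (u : moderateFunNets E X) :
    delta (Quotient.mk (pointSetoid E X) p) (GenFun.mk E X u) =
      GenNumber.mk ⟨fun ε => u.1 ε (p.1 ε), isModerate_eval p u.2⟩ :=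
  rfl

/-- Multiplicative `ℂ̃`-linear functionals on `𝒢(X)`. -/
def IsMultiplicativeLinear (φ : GenFun E X → GenNumber) : Prop :=
  IsLinearMap GenNumber φ ∧ ∀ u v, φ (u * v) = φ u * φ v

end Points

end Colombeau

/-! Let φ be a unital multiplicative functional. The key is `not_forall_le_norm_of_algHom_eq_zero`:
a net in the kernel of φ cannot stay above a power of ε on all of X along a set of parameters
accumulating at 0, for it would be invertible over those parameters and φ would kill their nonzero
characteristic idempotent. If u₁, …, uₙ lie in the kernel, so does ∑ uᵢ·conj(uᵢ) = ∑ |uᵢ|². Its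
infimum over X is therefore negligible, and near-minimizers form a common net of approximate zeros
of the uᵢ (`exists_forall_isNegligible`).

This is applied to g - φ(g), where g runs through a proper function f and finitely many smooth
functions separating the points of a compact set. Since φ(f) is bounded
(`algHom_realFunNet_bounded`), the resulting net p is compactly supported. For arbitrary u, adding u
- φ(u) to the list gives another net q. The separating functions agree up to negligible error along
p and q, so p and q define the same generalized point (`exists_riemDist_le`,
`isNegligibleDist_of_separating`), and φ(u) = u(q) = u(p). Thus p serves every u.

For a general multiplicative functional φ, e = φ(1) is idempotent, and adding (1 - e)·δ at any fixed
point gives a unital functional δ_p; multiplying by e yields φ = e·δ_p. Idempotents are classes of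
characteristic nets, hence real. -/

namespace Colombeau

open Filter Topology Asymptotics Bundle

/-! ### Negligible nets, and idempotents of the ring of generalized numbers. -/

section Numbers

instance neBot_toZero : NeBot toZero := by
  refine comap_neBot fun t ht => ?_
  obtain ⟨r, hr, h⟩ := Metric.mem_nhds_iff.1 ht
  have h1 : 0 < min r 1 / 2 := by positivity
  have h2 : min r 1 / 2 < 1 := by linarith [min_le_right r 1]
  have h3 : min r 1 / 2 < r := by linarith [min_le_left r 1]
  refine ⟨⟨min r 1 / 2, h1, h2⟩, h ?_⟩
  rw [Metric.mem_ball, dist_zero_right, Real.norm_of_nonneg h1.le]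
  exact h3

theorem eventually_lt_of_pos {r : ℝ} (hr : 0 < r) : ∀ᶠ ε : Param in toZero, (ε : ℝ) < r :=
  tendsto_toZero.eventually (Iio_mem_nhds hr)

theorem isNegligible_iff_norm {z : Param → ℂ} : IsNegligible z ↔
    ∀ b : ℝ, ∃ C : ℝ, ∀ᶠ ε : Param in toZero, ‖z ε‖ ≤ C * (ε : ℝ) ^ b := by
  have h (ε : Param) (b : ℝ) : ‖(ε : ℝ) ^ b‖ = (ε : ℝ) ^ b :=
    Real.norm_of_nonneg (Real.rpow_nonneg ε.2.1.le b)
  simp only [IsNegligible, isBigO_iff, h]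

theorem IsNegligible.mono {z w : Param → ℂ} (hw : IsNegligible w)
    (h : ∀ᶠ ε in toZero, ‖z ε‖ ≤ ‖w ε‖) : IsNegligible z :=
  fun b => (IsBigO.of_bound' h).trans (hw b)

theorem IsNegligible.add {z w : Param → ℂ} (hz : IsNegligible z) (hw : IsNegligible w) :
    IsNegligible fun ε => z ε + w ε :=
  fun b => (hz b).add (hw b)

theorem IsNegligible.sub {z w : Param → ℂ} (hz : IsNegligible z) (hw : IsNegligible w) :
    IsNegligible fun ε => z ε - w ε :=
  fun b => (hz b).sub (hw b)

theorem IsNegligible.tendsto {z : Param → ℂ} (hz : IsNegligible z) : Tendsto z toZero (𝓝 0) := by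
  refine (hz 1).trans_tendsto ?_
  simpa using tendsto_toZero

/-- A bound of order 2b on the square gives order b after a square root. This turns smallness of a
sum of squares into smallness of each term. -/
theorem IsNegligible.of_sq {z w : Param → ℂ} (hw : IsNegligible w)
    (h : ∀ᶠ ε in toZero, ‖z ε‖ ^ 2 ≤ ‖w ε‖) : IsNegligible z := by
  rw [isNegligible_iff_norm] at hw ⊢
  intro b
  obtain ⟨C, hC⟩ := hw (b + b)
  refine ⟨√|C|, ?_⟩
  filter_upwards [h, hC] with ε h1 h2
  have h0 := Real.rpow_pos_of_pos ε.2.1 b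
  refine le_of_sq_le_sq ?_ (by positivity)
  rw [mul_pow, Real.sq_sqrt (abs_nonneg C), sq ((ε : ℝ) ^ b), ← Real.rpow_add ε.2.1]
  exact (h1.trans h2).trans (mul_le_mul_of_nonneg_right (le_abs_self C)
    (Real.rpow_nonneg ε.2.1.le _))

theorem mk_eq_zero_iff {z : moderateNets} : GenNumber.mk z = 0 ↔ IsNegligible z.1 :=
  Ideal.Quotient.eq_zero_iff_mem

theorem mk_surjective : Function.Surjective GenNumber.mk := Ideal.Quotient.mk_surjective

/-- The characteristic net of a set of parameters. -/
noncomputable def charNet (S : Set Param) : moderateNets :=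
  ⟨S.indicator fun _ => 1, 0, by
    refine IsBigO.of_bound 1 (Eventually.of_forall fun ε => ?_)
    by_cases h : ε ∈ S <;> simp [h]⟩

theorem charNet_apply_of_mem {S : Set Param} {ε : Param} (h : ε ∈ S) : (charNet S).1 ε = 1 :=
  Set.indicator_of_mem h fun _ => (1 : ℂ)

theorem charNet_apply_of_notMem {S : Set Param} {ε : Param} (h : ε ∉ S) : (charNet S).1 ε = 0 :=
  Set.indicator_of_notMem h fun _ => (1 : ℂ)

/-- A negligible net tends to 0, whereas this one takes the value 1 at parameters arbitrarily close
to 0. -/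
theorem mk_charNet_ne_zero {S : Set Param} (hS : ∃ᶠ ε in toZero, ε ∈ S) :
    GenNumber.mk (charNet S) ≠ 0 := by
  intro h
  have h1 := (mk_eq_zero_iff.1 h).tendsto
  have h2 : ∀ᶠ ε in toZero, ‖(charNet S).1 ε‖ < 1 := by
    simpa using (h1.norm).eventually (Iio_mem_nhds (by simp : ‖(0 : ℂ)‖ < 1))
  obtain ⟨ε, hε, hlt⟩ := (hS.and_eventually h2).exists
  rw [charNet_apply_of_mem hε] at hlt
  simp at hlt

instance : Nontrivial GenNumber := by
  refine nontrivial_of_ne (GenNumber.mk (charNet Set.univ)) 0 (mk_charNet_ne_zero ?_)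
  exact (Eventually.of_forall fun _ => Set.mem_univ _).frequently

theorem mk_charNet_mem_realGenNumbers (S : Set Param) :
    GenNumber.mk (charNet S) ∈ realGenNumbers := by
  refine ⟨charNet S, fun ε => ?_, rfl⟩
  by_cases h : ε ∈ S
  · rw [charNet_apply_of_mem h]; rfl
  · rw [charNet_apply_of_notMem h]; rfl

/-- Every idempotent generalized number is the class of a characteristic net. -/
theorem exists_eq_mk_charNet {e : GenNumber} (he : IsIdempotentElem e) :
    ∃ S : Set Param, e = GenNumber.mk (charNet S) := by
  obtain ⟨z, rfl⟩ := mk_surjective e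
  -- The product |z|·|z - 1| is negligible and one factor is always at least 1/2, so the other is at
  -- most twice the product. The threshold 1/2 decides whether z is compared with 1 or with 0.
  refine ⟨{ε | 1 / 2 ≤ ‖z.1 ε‖}, ?_⟩
  have h : IsNegligible (z * z - z).1 := by
    rw [← mk_eq_zero_iff, map_sub, map_mul, he.eq, sub_self]
  rw [← sub_eq_zero, ← map_sub, mk_eq_zero_iff]
  have h2 : IsNegligible fun ε => 2 * (z * z - z).1 ε := fun b => (h b).const_mul_left 2
  refine h2.mono (Eventually.of_forall fun ε => ?_)
  have e1 : ‖2 * (z * z - z).1 ε‖ = 2 * (‖z.1 ε‖ * ‖z.1 ε - 1‖) := by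
    rw [norm_mul, ← norm_mul (z.1 ε)]
    simp [mul_sub]
  change ‖z.1 ε - (charNet _).1 ε‖ ≤ _
  rw [e1]
  by_cases hε : 1 / 2 ≤ ‖z.1 ε‖
  · rw [charNet_apply_of_mem (by exact hε)]
    nlinarith [norm_nonneg (z.1 ε - 1)]
  · rw [charNet_apply_of_notMem (by exact hε), sub_zero]
    have h3 : 1 ≤ ‖z.1 ε‖ + ‖z.1 ε - 1‖ := by
      simpa using norm_sub_le (z.1 ε) (z.1 ε - 1)
    nlinarith [norm_nonneg (z.1 ε)]

/-- The exponent 1/ε eventually exceeds any fixed b. The net is strictly positive at every ε, so it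
can serve as the slack when an infimum is not attained. -/
theorem isNegligible_rpow_inv :
    IsNegligible fun ε : Param => (((ε : ℝ) ^ (ε : ℝ)⁻¹ : ℝ) : ℂ) := by
  rw [isNegligible_iff_norm]
  intro b
  refine ⟨1, ?_⟩
  filter_upwards [eventually_lt_of_pos (r := (|b| + 1)⁻¹) (by positivity)] with ε hε
  rw [one_mul, Complex.norm_of_nonneg (Real.rpow_nonneg ε.2.1.le _)]
  refine Real.rpow_le_rpow_of_exponent_ge ε.2.1 ε.2.2.le ?_
  have := (lt_inv_comm₀ ε.2.1 (by positivity)).1 hε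
  linarith [le_abs_self b]

end Numbers

/-! ### Moderateness under conjugation and inversion, and nets that vanish locally. -/

section Nets

variable {E : Type*} [NormedAddCommGroup E] [NormedSpace ℝ E]
  {X : Type*} [TopologicalSpace X] [ChartedSpace E X]

theorem IsSmooth.inv {f : X → ℂ} (hf : IsSmooth E f) (h0 : ∀ x, f x ≠ 0) : IsSmooth E f⁻¹ :=
  fun x => (contDiffAt_inv ℝ (h0 x)).contMDiffAt.comp x (hf x)

theorem IsSmooth.conj {f : X → ℂ} (hf : IsSmooth E f) :
    IsSmooth E fun x => starRingEnd ℂ (f x) :=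
  Complex.conjCLE.contDiff.contMDiff.comp hf

theorem IsSmooth.ofReal {f : X → ℝ} (hf : ContMDiff 𝓘(ℝ, E) 𝓘(ℝ, ℝ) ∞ f) :
    IsSmooth E fun x => (f x : ℂ) :=
  Complex.ofRealCLM.contDiff.contMDiff.comp hf

variable [IsManifold 𝓘(ℝ, E) ∞ X]

/-- The Leibniz rule applied to f·f⁻¹ = 1. -/
theorem lieDeriv_inv (ξ : VectorField E X) {f : X → ℂ} (hf : IsSmooth E f) (h0 : ∀ x, f x ≠ 0) :
    lieDeriv ξ f⁻¹ = -(lieDeriv ξ f * (f⁻¹ * f⁻¹)) := by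
  have h1 : f * f⁻¹ = fun _ => 1 := funext fun x => mul_inv_cancel₀ (h0 x)
  have h2 := lieDeriv_mul ξ hf (hf.inv h0)
  rw [h1, lieDeriv_const] at h2
  funext x
  have h3 : 0 = lieDeriv ξ f x * (f x)⁻¹ + f x * lieDeriv ξ f⁻¹ x := congrFun h2 x
  change _ = -(lieDeriv ξ f x * ((f x)⁻¹ * (f x)⁻¹))
  have := h0 x
  field_simp at h3 ⊢
  linear_combination -h3

theorem lieDeriv_conj (ξ : VectorField E X) {f : X → ℂ} (hf : IsSmooth E f) :
    lieDeriv ξ (fun x => starRingEnd ℂ (f x)) = fun x => starRingEnd ℂ (lieDeriv ξ f x) := by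
  funext x
  have h := (Complex.conjCLE.toContinuousLinearMap.hasMFDerivAt (x := f x)).comp x
    (hf.mdifferentiableAt x).hasMFDerivAt
  simp only [lieDeriv]
  exact congrArg (fun L => L (ξ x)) h.mfderiv

theorem iterLieDeriv_conj (ξs : List (VectorField E X)) {f : X → ℂ} (hf : IsSmooth E f) :
    iterLieDeriv ξs (fun x => starRingEnd ℂ (f x)) =
      fun x => starRingEnd ℂ (iterLieDeriv ξs f x) := by
  induction ξs with
  | nil => rfl
  | cons ξ ξs ih =>
    change lieDeriv ξ (iterLieDeriv ξs _) = _
    rw [ih, lieDeriv_conj ξ (hf.iterLieDeriv ξs)]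
    rfl

theorem IsModerateNet.conj {u : Param → X → ℂ} (hu : IsModerateNet E u) :
    IsModerateNet E fun ε x => starRingEnd ℂ (u ε x) := by
  refine ⟨fun ε => (hu.1 ε).conj, fun K hK k => ?_⟩
  obtain ⟨b, hb⟩ := hu.2 K hK k
  refine ⟨b, fun ξs h => ?_⟩
  obtain ⟨C, hC⟩ := hb ξs h
  refine ⟨C, hC.mono fun ε hε p hp => ?_⟩
  beta_reduce
  rw [iterLieDeriv_conj ξs (hu.1 ε), RCLike.norm_conj]
  exact hε p hp

theorem isModerateNet_smooth {f : X → ℂ} (hf : IsSmooth E f) :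
    IsModerateNet E fun _ : Param => f := by
  refine ⟨fun _ => hf, fun K hK k => ⟨0, fun ξs _ => ?_⟩⟩
  obtain ⟨C, hC⟩ := hK.exists_bound_of_continuousOn (hf.iterLieDeriv ξs).continuous.continuousOn
  exact ⟨C, Eventually.of_forall fun ε p hp => by simpa using hC p hp⟩

/-- A moderate net that is bounded below by a power of `ε` has a moderate inverse. -/
theorem IsModerateNet.inv {u : Param → X → ℂ} (hu : IsModerateNet E u) {b : ℝ}
    (hb : ∀ ε : Param, ∀ x, (ε : ℝ) ^ b ≤ ‖u ε x‖) : IsModerateNet E fun ε => (u ε)⁻¹ := by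
  have h0 : ∀ ε x, u ε x ≠ 0 := fun ε x =>
    norm_pos_iff.1 ((Real.rpow_pos_of_pos ε.2.1 b).trans_le (hb ε x))
  refine ⟨fun ε => (hu.1 ε).inv (h0 ε), fun K hK k => ?_⟩
  -- All orders up to k are treated together, because the product estimate needs the lower
  -- derivatives of each factor.
  suffices H : ∃ a : ℝ, ∀ ξs : List (VectorField E X), ξs.length ≤ k →
      SupBigO K (fun ε => iterLieDeriv ξs (u ε)⁻¹) a from
    H.imp fun a ha ξs h => ha ξs h.le
  induction k with
  | zero =>
    refine ⟨-b, fun ξs h => ?_⟩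
    obtain rfl := List.length_eq_zero_iff.1 (Nat.le_zero.1 h)
    refine ⟨1, Eventually.of_forall fun ε p _ => ?_⟩
    change ‖(u ε p)⁻¹‖ ≤ _
    rw [norm_inv, one_mul, Real.rpow_neg ε.2.1.le]
    exact inv_anti₀ (Real.rpow_pos_of_pos ε.2.1 b) (hb ε p)
  | succ k ih =>
    obtain ⟨a, ha⟩ := ih
    obtain ⟨c, hc⟩ := hu.exists_le hK (k + 1)
    -- The innermost derivative of 1/u is -(ξu)·u⁻¹·u⁻¹: the factor ξu contributes the exponent c,
    -- with one order in reserve, and each inverse contributes a.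
    refine ⟨min a (c + (a + a)), fun ξs h => ?_⟩
    induction ξs using List.reverseRecOn with
    | nil => exact (ha [] (Nat.zero_le _)).mono (min_le_left _ _)
    | append_singleton ξs ξ _ =>
      rw [List.length_append, List.length_singleton, Nat.add_le_add_iff_right] at h
      refine SupBigO.mono ?_ (min_le_right _ _)
      have e : (fun ε => iterLieDeriv (ξs ++ [ξ]) (u ε)⁻¹) =
          -fun ε => iterLieDeriv ξs (lieDeriv ξ (u ε) * ((u ε)⁻¹ * (u ε)⁻¹)) := by
        funext ε
        rw [iterLieDeriv_concat, lieDeriv_inv ξ (hu.1 ε) (h0 ε), iterLieDeriv_neg]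
        rfl
      rw [e]
      refine SupBigO.neg (supBigO_iterLieDeriv_mul (v := fun ε => (u ε)⁻¹ * (u ε)⁻¹) ξs
        (fun ε => (hu.1 ε).lieDeriv ξ)
        (fun ε => ((hu.1 ε).inv (h0 ε)).mul ((hu.1 ε).inv (h0 ε)))
        (fun ηs h' => ?_) (fun ηs h' => ?_))
      · have := hc (ηs ++ [ξ]) (by simpa using h'.trans h)
        simpa only [iterLieDeriv_concat] using this
      · exact supBigO_iterLieDeriv_mul ηs (fun ε => (hu.1 ε).inv (h0 ε))
          (fun ε => (hu.1 ε).inv (h0 ε)) (fun ζs hζ => ha ζs (by lia))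
          (fun ζs hζ => ha ζs (by lia))

/-- Lie derivatives are local. -/
theorem iterLieDeriv_eq_zero_of_isOpen (ξs : List (VectorField E X)) {f : X → ℂ} {U : Set X}
    (hU : IsOpen U) (hf : ∀ x ∈ U, f x = 0) : ∀ x ∈ U, iterLieDeriv ξs f x = 0 := by
  induction ξs with
  | nil => exact hf
  | cons ξ ξs ih =>
    intro x hx
    change mfderiv 𝓘(ℝ, E) 𝓘(ℝ, ℂ) (iterLieDeriv ξs f) x (ξ x) = 0
    have h : iterLieDeriv ξs f =ᶠ[𝓝 x] fun _ => 0 := by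
      filter_upwards [hU.mem_nhds hx] with y hy using ih y hy
    rw [h.mfderiv_eq, mfderiv_const]
    rfl

/-- A net of smooth functions that eventually vanishes near every compact set is moderate. -/
theorem isModerateNet_of_eventually_eq_zero {u : Param → X → ℂ} (hu : ∀ ε, IsSmooth E (u ε))
    (h : ∀ K : Set X, IsCompact K → ∀ᶠ ε in toZero, ∃ U, IsOpen U ∧ K ⊆ U ∧ ∀ x ∈ U, u ε x = 0) :
    IsModerateNet E u := by
  refine ⟨hu, fun K hK k => ⟨0, fun ξs _ => ⟨0, (h K hK).mono ?_⟩⟩⟩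
  rintro ε ⟨U, hU, hKU, h0⟩ p hp
  beta_reduce
  rw [iterLieDeriv_eq_zero_of_isOpen ξs hU h0 p (hKU hp)]
  simp

theorem isNegligibleNet_of_eventually_eq_zero {u : Param → X → ℂ}
    (h : ∀ K : Set X, IsCompact K → ∀ᶠ ε in toZero, ∀ x ∈ K, u ε x = 0) :
    IsNegligibleNet u := by
  refine fun K hK b => ⟨0, (h K hK).mono fun ε hε p hp => ?_⟩
  simp [hε p hp]

end Nets

/-! ### Kernels of characters: approximate zeros and boundedness. -/

section Functionals

variable {E : Type*} [NormedAddCommGroup E] [NormedSpace ℝ E]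
  {X : Type*} [TopologicalSpace X] [ChartedSpace E X] [IsManifold 𝓘(ℝ, E) ∞ X]

theorem algHom_mk_constNets (φ : GenFun E X →ₐ[GenNumber] GenNumber) (z : moderateNets) :
    φ (GenFun.mk E X (constNets E X z)) = GenNumber.mk z :=
  φ.commutes (GenNumber.mk z)

/-- A generalized function in the kernel of a character is not bounded below by a power of `ε`
along a set of parameters that accumulates at `0`. -/
theorem not_forall_le_norm_of_algHom_eq_zero (φ : GenFun E X →ₐ[GenNumber] GenNumber)
    {w : moderateFunNets E X} (hw : φ (GenFun.mk E X w) = 0) {S : Set Param}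
    (hS : ∃ᶠ ε in toZero, ε ∈ S) (b : ℝ) : ¬ ∀ ε ∈ S, ∀ x, (ε : ℝ) ^ b ≤ ‖w.1 ε x‖ := by
  intro h
  -- The net t equals w on S and 1 off S, so it is bounded below at every parameter. In the exponent
  -- `max b 0`, the 0 takes care of the value 1.
  let t : moderateFunNets E X := constNets E X (charNet S) * w + constNets E X (1 - charNet S)
  have ht : ∀ ε x, t.1 ε x = (charNet S).1 ε * w.1 ε x + (1 - (charNet S).1 ε) := fun _ _ => rfl
  have hb : ∀ ε : Param, ∀ x, (ε : ℝ) ^ max b 0 ≤ ‖t.1 ε x‖ := by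
    intro ε x
    by_cases hε : ε ∈ S
    · rw [ht, charNet_apply_of_mem hε, one_mul, sub_self, add_zero]
      exact (Real.rpow_le_rpow_of_exponent_ge ε.2.1 ε.2.2.le (le_max_left _ _)).trans (h ε hε x)
    · rw [ht, charNet_apply_of_notMem hε, zero_mul, sub_zero, zero_add, norm_one]
      exact Real.rpow_le_one ε.2.1.le ε.2.2.le (le_max_right _ _)
  let v : moderateFunNets E X := ⟨fun ε => (t.1 ε)⁻¹, IsModerateNet.inv t.2 hb⟩
  have htv : t * v = 1 := by
    refine Subtype.ext (funext fun ε => funext fun x => mul_inv_cancel₀ (norm_pos_iff.1 ?_))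
    exact (Real.rpow_pos_of_pos ε.2.1 _).trans_le (hb ε x)
  have hidem : charNet S * (1 - charNet S) = 0 := by
    refine Subtype.ext (funext fun ε => ?_)
    change (charNet S).1 ε * (1 - (charNet S).1 ε) = 0
    by_cases hε : ε ∈ S
    · rw [charNet_apply_of_mem hε]; simp
    · rw [charNet_apply_of_notMem hε]; simp
  have h1 : φ (GenFun.mk E X t) = GenNumber.mk (1 - charNet S) := by
    rw [map_add, map_mul, map_add, map_mul, hw, mul_zero, zero_add, algHom_mk_constNets]
  have h2 : φ (GenFun.mk E X t) * φ (GenFun.mk E X v) = 1 := by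
    rw [← map_mul, ← map_mul, htv, map_one, map_one]
  -- Since φ(t) is the class of 1 - χ, with χ the characteristic net of S, and φ(t)·φ(v) = 1, the
  -- class of χ equals that of χ·(1 - χ) times φ(v), which is 0.
  refine mk_charNet_ne_zero hS ?_
  rw [← mul_one (GenNumber.mk (charNet S)), ← h2, h1, ← mul_assoc, ← map_mul, hidem, map_zero,
    zero_mul]

/-- The complex conjugate of a moderate net of functions. -/
noncomputable def conjNet (u : moderateFunNets E X) : moderateFunNets E X :=
  ⟨fun ε x => starRingEnd ℂ (u.1 ε x), IsModerateNet.conj u.2⟩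

theorem mul_conjNet_apply (u : moderateFunNets E X) (ε : Param) (x : X) :
    (u * conjNet u).1 ε x = ((‖u.1 ε x‖ ^ 2 : ℝ) : ℂ) := by
  change u.1 ε x * starRingEnd ℂ (u.1 ε x) = _
  rw [Complex.mul_conj']
  norm_cast

theorem sum_mul_conjNet_apply {ι : Type*} [Fintype ι] (u : ι → moderateFunNets E X)
    (ε : Param) (x : X) :
    (∑ i, u i * conjNet (u i)).1 ε x = ((∑ i, ‖(u i).1 ε x‖ ^ 2 : ℝ) : ℂ) := by
  rw [Complex.ofReal_sum, ← Finset.sum_congr rfl fun i _ => mul_conjNet_apply (u i) ε x]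
  rw [AddSubmonoidClass.coe_finsetSum, Finset.sum_apply, Finset.sum_apply]

/-- Finitely many generalized functions in the kernel of a character have a common net of
approximate zeros. -/
theorem exists_forall_isNegligible [Nonempty X] (φ : GenFun E X →ₐ[GenNumber] GenNumber)
    {ι : Type*} [Fintype ι] (u : ι → moderateFunNets E X)
    (hu : ∀ i, φ (GenFun.mk E X (u i)) = 0) :
    ∃ p : Param → X, ∀ i, IsNegligible fun ε => (u i).1 ε (p ε) := by
  -- Each summand has a factor in the kernel, so no compatibility of φ with conjugation is needed.
  let w : moderateFunNets E X := ∑ i, u i * conjNet (u i)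
  have hw : φ (GenFun.mk E X w) = 0 := by
    simp only [w, map_sum, map_mul, hu, zero_mul, Finset.sum_const_zero]
  have hwn : ∀ ε x, ‖w.1 ε x‖ = ∑ i, ‖(u i).1 ε x‖ ^ 2 := fun ε x => by
    rw [sum_mul_conjNet_apply, Complex.norm_of_nonneg (by positivity)]
  have hpos : ∀ ε : Param, 0 < (ε : ℝ) ^ (ε : ℝ)⁻¹ := fun ε => Real.rpow_pos_of_pos ε.2.1 _
  -- Near-minimizers of |w|, up to the negligible slack ε^(1/ε).
  choose p hp using fun ε : Param => exists_lt_of_ciInf_lt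
    (lt_add_of_pos_right (⨅ x, ‖w.1 ε x‖) (hpos ε))
  refine ⟨p, fun i => ?_⟩
  have hinf : IsNegligible fun ε => ((⨅ x, ‖w.1 ε x‖ : ℝ) : ℂ) := by
    rw [isNegligible_iff_norm]
    refine fun b => ⟨1, ?_⟩
    -- If the bound by ε^b fails, the parameters where the infimum exceeds ε^b accumulate at 0, and
    -- there |w| is at least ε^b on all of X.
    by_contra hcon
    refine not_forall_le_norm_of_algHom_eq_zero φ hw (S := {ε | ¬ _}) (not_eventually.1 hcon) b
      fun ε hε x => ?_
    have hε' := lt_of_not_ge hε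
    rw [one_mul, Complex.norm_of_nonneg (Real.iInf_nonneg fun _ => norm_nonneg _)] at hε'
    exact hε'.le.trans (ciInf_le ⟨0, by rintro _ ⟨y, rfl⟩; exact norm_nonneg _⟩ x)
  refine (hinf.add isNegligible_rpow_inv).of_sq
    (Eventually.of_forall fun ε => ?_)
  rw [← Complex.ofReal_add, Complex.norm_of_nonneg
    (add_nonneg (Real.iInf_nonneg fun _ => norm_nonneg _) (hpos ε).le)]
  refine le_trans ?_ (hp ε).le
  rw [hwn]
  exact Finset.single_le_sum (f := fun i => ‖(u i).1 ε (p ε)‖ ^ 2) (fun _ _ => by positivity)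
    (Finset.mem_univ i)

/-- S is the range of a sequence of parameters tending to 0 along which the n-th value of c exceeds
n. Divergence along the whole of S, not mere unboundedness, is what the cut-off argument for φ(f)
requires. -/
theorem exists_set_of_not_bounded {c : Param → ℝ}
    (hc : ¬ ∃ C : ℝ, ∀ᶠ ε in toZero, c ε ≤ C) :
    ∃ S : Set Param, (∃ᶠ ε in toZero, ε ∈ S) ∧ ∀ C : ℝ, ∀ᶠ ε in toZero, ε ∈ S → C < c ε := by
  push Not at hc
  have h : ∀ n : ℕ, ∃ ε : Param, (ε : ℝ) < 1 / ((n : ℝ) + 1) ∧ (n : ℝ) < c ε := fun n =>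
    ((hc n).and_eventually
      (eventually_lt_of_pos (r := 1 / ((n : ℝ) + 1)) (by positivity))).exists.imp
      fun ε h => ⟨h.2, h.1⟩
  choose x hx hcx using h
  have hlim : Tendsto x atTop toZero := tendsto_comap_iff.2
    (squeeze_zero (fun n => (x n).2.1.le) (fun n => (hx n).le)
      tendsto_one_div_add_atTop_nhds_zero_nat)
  refine ⟨Set.range x, hlim.frequently (Eventually.of_forall fun n => ⟨n, rfl⟩).frequently,
    fun C => ?_⟩
  -- Below the first ⌈C⌉ members of the sequence, a parameter in S can only be some `x n` with n ≥
  -- C.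
  have h1 : ∀ᶠ ε : Param in toZero, ∀ i ∈ Finset.range (⌈C⌉₊), (ε : ℝ) < x i :=
    (Finset.eventually_all _).2 fun i _ => eventually_lt_of_pos (x i).2.1
  filter_upwards [h1] with ε hε
  rintro ⟨n, rfl⟩
  refine lt_of_le_of_lt ?_ (hcx n)
  by_contra! hn
  exact lt_irrefl _ (hε n (Finset.mem_range.2 (Nat.lt_ceil.2 hn)))

/-- The net of constant value `f`, for a smooth real-valued function `f`. -/
noncomputable def realFunNet {f : X → ℝ} (hf : ContMDiff 𝓘(ℝ, E) 𝓘(ℝ, ℝ) ∞ f) :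
    moderateFunNets E X :=
  ⟨fun _ x => (f x : ℂ), isModerateNet_smooth (IsSmooth.ofReal hf)⟩

/-- A character maps a smooth function to a bounded generalized number. -/
theorem algHom_realFunNet_bounded (φ : GenFun E X →ₐ[GenNumber] GenNumber) {f : X → ℝ}
    (hf : ContMDiff 𝓘(ℝ, E) 𝓘(ℝ, ℝ) ∞ f) (hf0 : ∀ x, 0 ≤ f x) {c : moderateNets}
    (hc : φ (GenFun.mk E X (realFunNet hf)) = GenNumber.mk c) :
    ∃ C : ℝ, ∀ᶠ ε in toZero, ‖c.1 ε‖ ≤ C := by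
  by_contra hcon
  obtain ⟨S, hS, hSc⟩ := exists_set_of_not_bounded hcon
  -- A cut-off living on S, equal to 0 where f ≤ |c|/2 and to 1 where f ≥ |c|/2 + 1. As |c| → ∞
  -- along S while f is bounded on compact sets, it eventually vanishes near each compact set and so
  -- represents 0.
  let h : Param → X → ℂ := fun ε x =>
    (charNet S).1 ε * ((Real.smoothTransition (f x - ‖c.1 ε‖ / 2) : ℝ) : ℂ)
  have h_smooth : ∀ ε, IsSmooth E (h ε) := by
    intro ε
    refine (isSmooth_const _).mul (IsSmooth.ofReal ?_)
    exact (Real.smoothTransition.contDiff (n := ⊤)).contMDiff.comp (hf.sub contMDiff_const)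
  have h_zero : ∀ K : Set X, IsCompact K →
      ∀ᶠ ε in toZero, ∃ U, IsOpen U ∧ K ⊆ U ∧ ∀ x ∈ U, h ε x = 0 := by
    intro K hK
    obtain ⟨C, hC⟩ := hK.exists_bound_of_continuousOn hf.continuous.continuousOn
    filter_upwards [hSc (2 * C)] with ε hε
    by_cases hεS : ε ∈ S
    · refine ⟨{x | f x < ‖c.1 ε‖ / 2}, isOpen_lt hf.continuous continuous_const, fun x hx => ?_,
        fun x hx => ?_⟩
      · have h1 := (le_abs_self _).trans (hC x hx)
        have h2 := hε hεS
        change f x < _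
        linarith
      · change _ * _ = _
        rw [Real.smoothTransition.zero_of_nonpos (sub_nonpos.2 (le_of_lt hx))]
        simp
    · refine ⟨Set.univ, isOpen_univ, Set.subset_univ _, fun x _ => ?_⟩
      change _ * _ = _
      rw [charNet_apply_of_notMem hεS, zero_mul]
  let h' : moderateFunNets E X := ⟨h, isModerateNet_of_eventually_eq_zero h_smooth h_zero⟩
  have hh' : GenFun.mk E X h' = 0 := Ideal.Quotient.eq_zero_iff_mem.2
    (isNegligibleNet_of_eventually_eq_zero fun K hK => (h_zero K hK).mono
      fun ε ⟨U, _, hKU, hU⟩ x hx => hU x (hKU hx))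
  let g : moderateFunNets E X := realFunNet hf - constNets E X c
  have hg : φ (GenFun.mk E X g) = 0 := by
    rw [map_sub, map_sub, hc, algHom_mk_constNets, sub_self]
  -- The term h' does not change the class but raises the representative to at least 1 once |c| > 4
  -- on S. If f ≤ 3|c|/4, then |f - c| ≥ |c|/4 > 1; otherwise f - |c|/2 ≥ |c|/4 > 1 and the cut-off
  -- is 1.
  let w : moderateFunNets E X := g * conjNet g + h'
  have hw : φ (GenFun.mk E X w) = 0 := by
    rw [map_add, hh', add_zero, map_mul, map_mul, hg, zero_mul]
  refine not_forall_le_norm_of_algHom_eq_zero φ hw (S := {ε | ε ∈ S ∧ _})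
    (hS.and_eventually (hSc 4)) 0
    fun ε ⟨hεS, hε⟩ x => ?_
  have hε4 := hε hεS
  have hwx : w.1 ε x =
      ((‖(f x : ℂ) - c.1 ε‖ ^ 2 + Real.smoothTransition (f x - ‖c.1 ε‖ / 2) : ℝ) : ℂ) := by
    change (g * conjNet g).1 ε x + (charNet S).1 ε * _ = _
    rw [mul_conjNet_apply, charNet_apply_of_mem hεS, one_mul, Complex.ofReal_add]
    rfl
  have h0 := Real.smoothTransition.nonneg (f x - ‖c.1 ε‖ / 2)
  rw [hwx, Complex.norm_of_nonneg (by positivity), Real.rpow_zero]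
  rcases le_total (f x) (3 / 4 * ‖c.1 ε‖) with hle | hle
  · have h1 : ‖c.1 ε‖ - f x ≤ ‖(f x : ℂ) - c.1 ε‖ := by
      have := norm_sub_norm_le (c.1 ε) (f x : ℂ)
      rwa [Complex.norm_of_nonneg (hf0 x), norm_sub_rev] at this
    nlinarith
  · rw [Real.smoothTransition.one_of_one_le (by linarith)]
    nlinarith [sq_nonneg ‖(f x : ℂ) - c.1 ε‖]

/-- On the empty manifold 0 = 1 among nets, and a unital φ would carry this to `GenNumber`, which is
nontrivial. -/
theorem nonempty_of_algHom (φ : GenFun E X →ₐ[GenNumber] GenNumber) : Nonempty X := by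
  by_contra hX
  rw [not_nonempty_iff] at hX
  have h : (0 : moderateFunNets E X) = 1 := Subtype.ext (funext fun _ => funext fun x => hX.elim x)
  refine zero_ne_one (α := GenNumber) ?_
  rw [← map_zero φ, ← map_one φ, ← map_zero (GenFun.mk E X), ← map_one (GenFun.mk E X), h]

theorem IsMultiplicativeLinear.map_one_of_surjective {φ : GenFun E X → GenNumber}
    (hφ : IsMultiplicativeLinear φ) (hs : Function.Surjective φ) : φ 1 = 1 := by
  obtain ⟨u, hu⟩ := hs 1
  have := hφ.2 u 1
  rwa [mul_one, hu, one_mul, eq_comm] at this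

end Functionals

/-! ### Riemannian distance bounded by chart distance. -/

section LocalLipschitz

variable {E : Type*} [NormedAddCommGroup E] [NormedSpace ℝ E]
  {X : Type*} [TopologicalSpace X] [ChartedSpace E X]

theorem exists_enorm_mfderivWithin_symm_extChartAt_le [IsManifold 𝓘(ℝ, E) 1 X]
    [RiemannianBundle (TangentSpace 𝓘(ℝ, E) : X → Type _)]
    [IsContinuousRiemannianBundle E (TangentSpace 𝓘(ℝ, E) : X → Type _)] (x : X) :
    ∃ C : NNReal, ∀ᶠ y in 𝓝[Set.range 𝓘(ℝ, E)] (extChartAt 𝓘(ℝ, E) x x), ∀ v : E,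
      ‖mfderivWithin 𝓘(ℝ, E) 𝓘(ℝ, E) (extChartAt 𝓘(ℝ, E) x).symm (Set.range 𝓘(ℝ, E)) y v‖ₑ ≤
        C * ‖v‖ₑ := by
  obtain ⟨C, -, hC⟩ := eventually_enorm_mfderivWithin_symm_extChartAt_lt 𝓘(ℝ, E) x
  refine ⟨C, hC.mono fun y hy v => ?_⟩
  exact (ContinuousLinearMap.le_opENorm (E := E)
    (F := TangentSpace 𝓘(ℝ, E) ((extChartAt 𝓘(ℝ, E) x).symm y)) _ v).trans
      (mul_le_mul_left hy.le _)

/-- The Riemannian distance of two points near `x` is controlled by their distance in the chart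
at `x`. -/
theorem exists_riemannianEDist_le_edist_extChartAt [IsManifold 𝓘(ℝ, E) 1 X]
    [RiemannianBundle (TangentSpace 𝓘(ℝ, E) : X → Type _)]
    [IsContinuousRiemannianBundle E (TangentSpace 𝓘(ℝ, E) : X → Type _)] (x : X) :
    ∃ C : NNReal, ∃ V ∈ 𝓝 x, ∀ y ∈ V, ∀ z ∈ V, Manifold.riemannianEDist 𝓘(ℝ, E) y z ≤
      C * edist (extChartAt 𝓘(ℝ, E) x y) (extChartAt 𝓘(ℝ, E) x z) := by
  obtain ⟨C, hC⟩ := exists_enorm_mfderivWithin_symm_extChartAt_le (E := E) x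
  obtain ⟨r, r_pos, hr⟩ := Metric.mem_nhdsWithin_iff.1
    (inter_mem (extChartAt_target_mem_nhdsWithin (I := 𝓘(ℝ, E)) x) hC)
  rw [ModelWithCorners.range_eq_univ, Set.inter_univ] at hr
  refine ⟨C, extChartAt 𝓘(ℝ, E) x ⁻¹' Metric.ball (extChartAt 𝓘(ℝ, E) x x) r ∩
    (chartAt E x).source, inter_mem ((continuousAt_extChartAt x).preimage_mem_nhds
      (Metric.ball_mem_nhds _ r_pos)) (chart_source_mem_nhds E x), ?_⟩
  rintro y ⟨hy, h'y⟩ z ⟨hz, h'z⟩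
  -- The competitor path is the straight segment in the chart, pulled back to X. It stays in the
  -- ball by convexity, and there the derivative of the inverse chart is bounded by C.
  let η := ContinuousAffineMap.lineMap (R := ℝ) (extChartAt 𝓘(ℝ, E) x y) (extChartAt 𝓘(ℝ, E) x z)
  set γ := (extChartAt 𝓘(ℝ, E) x).symm ∘ η
  have hη : Set.Icc 0 1 ⊆ ⇑η ⁻¹' ((extChartAt 𝓘(ℝ, E) x).target ∩
      {y | ∀ v : E, ‖mfderivWithin 𝓘(ℝ, E) 𝓘(ℝ, E) (extChartAt 𝓘(ℝ, E) x).symm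
        (Set.range 𝓘(ℝ, E)) y v‖ₑ ≤ C * ‖v‖ₑ}) := by
    simp only [← Set.image_subset_iff, ContinuousAffineMap.coe_lineMap_eq,
      ← segment_eq_image_lineMap, η]
    rw [ModelWithCorners.range_eq_univ]
    exact ((convex_ball _ _).segment_subset hy hz).trans hr
  simp only [Set.preimage_inter, Set.subset_inter_iff] at hη
  have η_smooth : ContMDiffOn 𝓘(ℝ, ℝ) 𝓘(ℝ, E) 1 η (Set.Icc 0 1) := by
    apply ContMDiff.contMDiffOn
    rw [contMDiff_iff_contDiff]
    exact ContinuousAffineMap.contDiff _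
  have hle : Manifold.riemannianEDist 𝓘(ℝ, E) y z ≤ Manifold.pathELength 𝓘(ℝ, E) γ 0 1 := by
    apply Manifold.riemannianEDist_le_pathELength _ _ _ zero_le_one
    · exact (contMDiffOn_extChartAt_symm x).comp η_smooth hη.1
    · simp [γ, η, ContinuousAffineMap.coe_lineMap_eq, h'y]
    · simp [γ, η, ContinuousAffineMap.coe_lineMap_eq, h'z]
  apply hle.trans
  rw [← lintegral_fderiv_lineMap_eq_edist, Manifold.pathELength_eq_lintegral_mfderivWithin_Icc,
    ← MeasureTheory.lintegral_const_mul' _ _ ENNReal.coe_ne_top]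
  apply MeasureTheory.setLIntegral_mono' measurableSet_Icc (fun t ht ↦ ?_)
  have hcomp : mfderivWithin 𝓘(ℝ, ℝ) 𝓘(ℝ, E) γ (Set.Icc 0 1) t =
      (mfderivWithin 𝓘(ℝ, E) 𝓘(ℝ, E) (extChartAt 𝓘(ℝ, E) x).symm (Set.range 𝓘(ℝ, E)) (η t)) ∘L
        (mfderivWithin 𝓘(ℝ, ℝ) 𝓘(ℝ, E) η (Set.Icc 0 1) t) := by
    apply mfderivWithin_comp
    · exact mdifferentiableWithinAt_extChartAt_symm (hη.1 ht)
    · exact η_smooth.mdifferentiableOn one_ne_zero t ht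
    · exact hη.1.trans (Set.preimage_mono (extChartAt_target_subset_range x))
    · rw [uniqueMDiffWithinAt_iff_uniqueDiffWithinAt]
      exact uniqueDiffOn_Icc zero_lt_one t ht
  have happ : mfderivWithin 𝓘(ℝ, ℝ) 𝓘(ℝ, E) γ (Set.Icc 0 1) t 1 =
      (mfderivWithin 𝓘(ℝ, E) 𝓘(ℝ, E) (extChartAt 𝓘(ℝ, E) x).symm (Set.range 𝓘(ℝ, E)) (η t))
        (mfderivWithin 𝓘(ℝ, ℝ) 𝓘(ℝ, E) η (Set.Icc 0 1) t 1) := congr($hcomp 1)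
  rw [happ]
  refine (hη.2 ht _).trans (le_of_eq ?_)
  rw [mfderivWithin_eq_fderivWithin]
  rfl

end LocalLipschitz

/-! ### From close values of separating functions to close points. -/

section Separating

variable {E : Type*} [NormedAddCommGroup E] [NormedSpace ℝ E]
  {X : Type*} [TopologicalSpace X] [ChartedSpace E X] [IsManifold 𝓘(ℝ, E) ∞ X]

/-- Two nets of points in a compact set have negligible distance if finitely many separating
functions differ negligibly along them. -/
theorem isNegligibleDist_of_separating {h : RiemMetric E X} {K : Set X} {S : Set (X → ℝ)}
    (hS : S.Finite) {C δ : ℝ} (hC : 0 ≤ C) (hδ : 0 < δ)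
    (H : ∀ y ∈ K, ∀ z, ∀ r, 0 ≤ r → r ≤ δ →
      (∀ f ∈ S, |f y - f z| ≤ r) → riemDist h y z ≤ ENNReal.ofReal (C * r))
    {p q : Param → X} (hp : ∀ᶠ ε in toZero, p ε ∈ K)
    (hpq : ∀ f ∈ S, IsNegligible fun ε => (f (p ε) : ℂ) - f (q ε)) : IsNegligibleDist h p q := by
  intro b
  -- The exponent `max b 1` yields the required order b and also a power at most ε, so that the
  -- radius A·ε^(max b 1) falls below δ once ε < δ/(A + 1).
  have h1 : ∀ f ∈ S, ∃ D : ℝ, ∀ᶠ ε : Param in toZero,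
      |f (p ε) - f (q ε)| ≤ D * (ε : ℝ) ^ max b 1 := by
    intro f hf
    obtain ⟨D, hD⟩ := isNegligible_iff_norm.1 (hpq f hf) (max b 1)
    refine ⟨D, hD.mono fun ε hε => ?_⟩
    rwa [← Complex.ofReal_sub, Complex.norm_real] at hε
  choose! D hD using h1
  let A : ℝ := ∑ f ∈ hS.toFinset, |D f|
  have hA : 0 ≤ A := Finset.sum_nonneg fun _ _ => abs_nonneg _
  refine ⟨C * A, ?_⟩
  filter_upwards [hp, (eventually_all_finite hS).2 hD,
    eventually_lt_of_pos (r := δ / (A + 1)) (by positivity)] with ε hpε hDε hε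
  have h0 := Real.rpow_pos_of_pos ε.2.1 (max b 1)
  have hε1 : (ε : ℝ) ^ max b 1 ≤ ε := by
    simpa using Real.rpow_le_rpow_of_exponent_ge ε.2.1 ε.2.2.le (le_max_right b 1)
  have hεb : (ε : ℝ) ^ max b 1 ≤ (ε : ℝ) ^ b :=
    Real.rpow_le_rpow_of_exponent_ge ε.2.1 ε.2.2.le (le_max_left b 1)
  refine (H _ hpε (q ε) (A * (ε : ℝ) ^ max b 1) (by positivity) ?_ fun f hf => ?_).trans
    (ENNReal.ofReal_le_ofReal ?_)
  · rw [lt_div_iff₀ (by positivity)] at hε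
    nlinarith [ε.2.1]
  · refine (hDε f hf).trans (mul_le_mul_of_nonneg_right ?_ h0.le)
    exact (le_abs_self _).trans (Finset.single_le_sum (f := fun f => |D f|)
      (fun _ _ => abs_nonneg _) (hS.mem_toFinset.2 hf))
  · rw [mul_assoc]
    gcongr

end Separating

/-! ### Construction of separating functions and of a proper function. -/

section Separation

variable {E : Type*} [NormedAddCommGroup E] [NormedSpace ℝ E] [FiniteDimensional ℝ E]
  {X : Type*} [TopologicalSpace X] [T2Space X] [ChartedSpace E X] [IsManifold 𝓘(ℝ, E) ∞ X]

/-- The functions are a bump ψ at x and the coordinates of ψ times the chart. The bump makes the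
estimate valid for every z in X: where ψ(y) = 1, a value ψ(z) close to 1 already forces z into the
chart neighbourhood. -/
theorem exists_local_riemDist_le (h : RiemMetric E X) (x : X) :
    ∃ S : Set (X → ℝ), S.Finite ∧ (∀ f ∈ S, ContMDiff 𝓘(ℝ, E) 𝓘(ℝ, ℝ) ∞ f) ∧
      ∃ C : ℝ, 0 ≤ C ∧ ∃ δ : ℝ, 0 < δ ∧ ∀ᶠ y in 𝓝 x, ∀ z, ∀ r ≤ δ,
        (∀ f ∈ S, |f y - f z| ≤ r) → riemDist h y z ≤ ENNReal.ofReal (C * r) := by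
  let : RiemannianBundle (TangentSpace 𝓘(ℝ, E) : X → Type _) := ⟨h.toRiemannianMetric⟩
  have : IsContinuousRiemannianBundle E (TangentSpace 𝓘(ℝ, E) : X → Type _) :=
    ⟨⟨h.inner, h.contMDiff.continuous, fun _ _ _ => rfl⟩⟩
  have : IsManifold 𝓘(ℝ, E) 1 X := IsManifold.of_le (n := ∞) (by exact_mod_cast le_top)
  obtain ⟨C, V, hV, hC⟩ := exists_riemannianEDist_le_edist_extChartAt (E := E) x
  let φ : X → E := extChartAt 𝓘(ℝ, E) x
  have hV' : V ∩ φ ⁻¹' Metric.ball (φ x) 1 ∈ 𝓝 x :=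
    inter_mem hV ((continuousAt_extChartAt x).preimage_mem_nhds (Metric.ball_mem_nhds _ one_pos))
  obtain ⟨ψ, -, hψ⟩ := (SmoothBumpFunction.nhds_basis_tsupport (I := 𝓘(ℝ, E)) x).mem_iff.1 hV'
  have hG : ContMDiff 𝓘(ℝ, E) 𝓘(ℝ, E) ∞ fun y => ψ y • φ y :=
    ψ.contMDiff_smul contMDiffOn_extChartAt
  let b := Module.finBasis ℝ E
  let g : Fin (Module.finrank ℝ E) → X → ℝ := fun i y => b.coord i (ψ y • φ y)
  let D : ℝ := ∑ i, ‖b i‖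
  let B : ℝ := ‖φ x‖ + 1
  have hB : ∀ z ∈ V ∩ φ ⁻¹' Metric.ball (φ x) 1, ‖φ z‖ ≤ B := by
    rintro z ⟨-, hz⟩
    have h1 : ‖φ z - φ x‖ < 1 := mem_ball_iff_norm.1 hz
    have h2 := norm_sub_norm_le (φ z) (φ x)
    change _ ≤ ‖φ x‖ + 1
    linarith
  -- D passes from coordinates to the norm of E, and B bounds the chart on the support of ψ. With δ
  -- = 1/2, the inequality |1 - ψ(z)| ≤ δ excludes ψ(z) = 0.
  refine ⟨insert (ψ : X → ℝ) (Set.range g), (Set.finite_range g).insert _, ?_, C * (D + B),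
    by positivity, 1 / 2, by norm_num, ?_⟩
  · rintro f (rfl | ⟨i, rfl⟩)
    · exact ψ.contMDiff
    · exact (LinearMap.toContinuousLinearMap (b.coord i)).contDiff.contMDiff.comp hG
  filter_upwards [ψ.eventuallyEq_one, hV'] with y hy1 hyV z r hr hf
  have hψy : ψ y = 1 := hy1
  have hr0 : 0 ≤ r := (abs_nonneg _).trans (hf ψ (Set.mem_insert _ _))
  have hψz : |1 - ψ z| ≤ r := hψy ▸ hf ψ (Set.mem_insert _ _)
  have hz : z ∈ V ∩ φ ⁻¹' Metric.ball (φ x) 1 := by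
    refine hψ (subset_tsupport _ ?_)
    intro h0
    rw [h0, sub_zero, abs_one] at hψz
    linarith
  have hGyz : ‖ψ y • φ y - ψ z • φ z‖ ≤ D * r := by
    rw [← b.sum_repr (ψ y • φ y - ψ z • φ z), Finset.sum_mul]
    refine (norm_sum_le _ _).trans (Finset.sum_le_sum fun i _ => ?_)
    rw [norm_smul, mul_comm]
    refine mul_le_mul_of_nonneg_left ?_ (norm_nonneg _)
    have := hf (g i) (Set.mem_insert_of_mem _ ⟨i, rfl⟩)
    simpa [g] using this
  have hφ : ‖φ y - φ z‖ ≤ (D + B) * r := by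
    -- The second term corrects for ψ(z) differing from 1; it costs at most B·r.
    have e : φ y - φ z = (ψ y • φ y - ψ z • φ z) - (1 - ψ z) • φ z := by
      rw [hψy]
      module
    rw [e, add_mul]
    refine (norm_sub_le _ _).trans (add_le_add hGyz ?_)
    rw [norm_smul, mul_comm]
    exact mul_le_mul (hB z hz) hψz (norm_nonneg _) (by positivity)
  refine (hC y hyV.1 z hz.1).trans ?_
  rw [mul_assoc, ENNReal.ofReal_mul (NNReal.coe_nonneg C), ENNReal.ofReal_coe_nnreal, edist_dist,
    dist_eq_norm]
  gcongr

/-- Finitely many smooth functions separate the points of a compact set, with a Lipschitz bound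
for the Riemannian distance. -/
theorem exists_riemDist_le (h : RiemMetric E X) {K : Set X} (hK : IsCompact K) :
    ∃ S : Set (X → ℝ), S.Finite ∧ (∀ f ∈ S, ContMDiff 𝓘(ℝ, E) 𝓘(ℝ, ℝ) ∞ f) ∧
      ∃ C : ℝ, 0 ≤ C ∧ ∃ δ : ℝ, 0 < δ ∧ ∀ y ∈ K, ∀ z, ∀ r, 0 ≤ r → r ≤ δ →
        (∀ f ∈ S, |f y - f z| ≤ r) → riemDist h y z ≤ ENNReal.ofReal (C * r) := by
  refine hK.induction_on (p := fun K => ∃ S : Set (X → ℝ), S.Finite ∧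
    (∀ f ∈ S, ContMDiff 𝓘(ℝ, E) 𝓘(ℝ, ℝ) ∞ f) ∧
      ∃ C : ℝ, 0 ≤ C ∧ ∃ δ : ℝ, 0 < δ ∧ ∀ y ∈ K, ∀ z, ∀ r, 0 ≤ r → r ≤ δ →
        (∀ f ∈ S, |f y - f z| ≤ r) → riemDist h y z ≤ ENNReal.ofReal (C * r)) ?_ ?_ ?_ ?_
  · exact ⟨∅, Set.finite_empty, by simp, 0, le_rfl, 1, one_pos, fun y hy => hy.elim⟩
  · rintro s t hst ⟨S, hS, hSf, C, hC, δ, hδ, H⟩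
    exact ⟨S, hS, hSf, C, hC, δ, hδ, fun y hy => H y (hst hy)⟩
  · rintro s t ⟨S, hS, hSf, C, hC, δ, hδ, H⟩ ⟨S', hS', hSf', C', hC', δ', hδ', H'⟩
    refine ⟨S ∪ S', hS.union hS', ?_, max C C', le_max_of_le_left hC, min δ δ', lt_min hδ hδ', ?_⟩
    · rintro f (hf | hf)
      exacts [hSf f hf, hSf' f hf]
    · rintro y (hy | hy) z r hr0 hr hf
      · refine (H y hy z r hr0 (hr.trans (min_le_left _ _)) fun f hfS => hf f (Or.inl hfS)).trans
          (ENNReal.ofReal_le_ofReal ?_)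
        gcongr
        exact le_max_left _ _
      · refine (H' y hy z r hr0 (hr.trans (min_le_right _ _)) fun f hfS => hf f (Or.inr hfS)).trans
          (ENNReal.ofReal_le_ofReal ?_)
        gcongr
        exact le_max_right _ _
  · intro x _
    obtain ⟨S, hS, hSf, C, hC, δ, hδ, H⟩ := exists_local_riemDist_le h x
    exact ⟨_, mem_nhdsWithin_of_mem_nhds H, S, hS, hSf, C, hC, δ, hδ,
      fun y hy z r _ hr hf => hy z r hr hf⟩

variable [SecondCountableTopology X]

variable (E X) in
/-- Every smooth manifold carries a smooth nonnegative proper function. -/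
theorem exists_smooth_exhaustion : ∃ f : X → ℝ, ContMDiff 𝓘(ℝ, E) 𝓘(ℝ, ℝ) ∞ f ∧
    (∀ x, 0 ≤ f x) ∧ ∀ C : ℝ, ∃ K : Set X, IsCompact K ∧ ∀ x, f x ≤ C → x ∈ K := by
  have : LocallyCompactSpace X := ChartedSpace.locallyCompactSpace E X
  let K : CompactExhaustion X := default
  -- It suffices that f dominate the index of the first exhausting set containing x. Near x this
  -- index is at most its value at x plus 1, so constants work locally, and convexity of half-lines
  -- lets a partition of unity glue them.
  obtain ⟨f, hf⟩ := exists_contMDiffMap_forall_mem_convex_of_local_const (n := ⊤) 𝓘(ℝ, E)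
    (t := fun x : X => Set.Ici (K.find x : ℝ)) (fun x => convex_Ici _) (fun x => by
      refine ⟨((K.find x + 1 : ℕ) : ℝ), ?_⟩
      filter_upwards [isOpen_interior.mem_nhds
        (K.subset_interior_succ _ (K.mem_find x))] with y hy
      exact (Nat.cast_le (α := ℝ)).2 (K.mem_iff_find_le.1 (interior_subset hy)))
  refine ⟨f, f.contMDiff, fun x => (Nat.cast_nonneg _).trans (hf x),
    fun C => ⟨K ⌈C⌉₊, K.isCompact _, fun x hx => K.mem_iff_find_le.2 ?_⟩⟩
  have h1 : (K.find x : ℝ) ≤ C := (hf x).trans hx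
  exact (Nat.cast_le (α := ℝ)).1 (h1.trans (Nat.le_ceil C))

end Separation

/-! ### Characters are evaluations; reduction of the general case to characters. -/

section Characters

variable {E : Type*} [NormedAddCommGroup E] [NormedSpace ℝ E] [FiniteDimensional ℝ E]
  {X : Type*} [TopologicalSpace X] [T2Space X] [SecondCountableTopology X] [ChartedSpace E X]
  [IsManifold 𝓘(ℝ, E) ∞ X]

/-- The characters of `𝒢(X)` are the evaluations at compactly supported generalized points. -/
theorem exists_eq_delta_of_algHom (φ : GenFun E X →ₐ[GenNumber] GenNumber) :
    ∃ p : GenPoint E X, ∀ u, φ u = delta p u := by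
  have : Nonempty X := nonempty_of_algHom φ
  obtain ⟨h⟩ := nonempty_riemMetric E X
  obtain ⟨f, hf, hf0, hfK⟩ := exists_smooth_exhaustion E X
  obtain ⟨c, hc⟩ := mk_surjective (φ (GenFun.mk E X (realFunNet hf)))
  obtain ⟨B, hB⟩ := algHom_realFunNet_bounded φ hf hf0 hc.symm
  -- Along approximate zeros of f - c one has |f - c| < 1 eventually, and |c| ≤ B, so f ≤ B + 1.
  obtain ⟨K, hK, hfK⟩ := hfK (B + 1)
  obtain ⟨S, hS, hSf, C, hC, δ, hδ, hSC⟩ := exists_riemDist_le h hK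
  have : Fintype S := hS.fintype
  have hex : ∀ g : moderateFunNets E X, ∃ z : moderateNets,
      φ (GenFun.mk E X (g - constNets E X z)) = 0 := by
    intro g
    obtain ⟨z, hz⟩ := mk_surjective (φ (GenFun.mk E X g))
    exact ⟨z, by rw [map_sub, map_sub, algHom_mk_constNets, hz, sub_self]⟩
  choose z hz using fun g : S => hex (realFunNet (hSf g g.2))
  let G : Option S → moderateFunNets E X := fun i => i.elim (realFunNet hf - constNets E X c)
    fun g => realFunNet (hSf g g.2) - constNets E X (z g)
  have hG : ∀ i, φ (GenFun.mk E X (G i)) = 0 := by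
    rintro (_ | g)
    · change φ (GenFun.mk E X (realFunNet hf - constNets E X c)) = 0
      rw [map_sub, map_sub, algHom_mk_constNets, hc, sub_self]
    · exact hz g
  have hmem : ∀ p : Param → X, (IsNegligible fun ε => (G none).1 ε (p ε)) →
      ∀ᶠ ε in toZero, p ε ∈ K := by
    intro p hp
    filter_upwards [hB, hp.tendsto.norm.eventually
      (Iio_mem_nhds (by simp : ‖(0 : ℂ)‖ < 1))] with ε h1 h2
    have h3 : ‖(f (p ε) : ℂ) - c.1 ε‖ < 1 := h2
    have h4 := norm_sub_norm_le (f (p ε) : ℂ) (c.1 ε)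
    rw [Complex.norm_of_nonneg (hf0 _)] at h4
    exact hfK _ (by linarith)
  -- This p is fixed before any u is considered.
  obtain ⟨p, hp⟩ := exists_forall_isNegligible φ G hG
  let p' : PointNet X := ⟨p, K, hK, hmem p (hp none)⟩
  refine ⟨Quotient.mk (pointSetoid E X) p', fun u => ?_⟩
  obtain ⟨u, rfl⟩ : ∃ v, GenFun.mk E X v = u := Ideal.Quotient.mk_surjective u
  obtain ⟨w, hw⟩ := mk_surjective (φ (GenFun.mk E X u))
  -- The net q depends on u, but it also solves the system defining p.
  obtain ⟨q, hq⟩ := exists_forall_isNegligible φ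
    (fun i : Option (Option S) => i.elim (u - constNets E X w) G) (by
      rintro (_ | i)
      · change φ (GenFun.mk E X (u - constNets E X w)) = 0
        rw [map_sub, map_sub, algHom_mk_constNets, hw, sub_self]
      · exact hG i)
  let q' : PointNet X := ⟨q, K, hK, hmem q (hq (some none))⟩
  -- Along both nets each separating function g is negligibly close to the same net z representing
  -- φ(g).
  have hpq : IsNegligibleDist h p'.1 q'.1 := by
    refine isNegligibleDist_of_separating hS hC hδ hSC (hmem p (hp none)) fun g hg => ?_
    have h1 : IsNegligible fun ε => (g (p ε) : ℂ) - (z ⟨g, hg⟩).1 ε := hp (some ⟨g, hg⟩)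
    have h2 : IsNegligible fun ε => (g (q ε) : ℂ) - (z ⟨g, hg⟩).1 ε := hq (some (some ⟨g, hg⟩))
    simpa only [sub_sub_sub_cancel_right] using h1.sub h2
  have h1 : IsNegligible fun ε => u.1 ε (q ε) - u.1 ε (p ε) := hpq.isNegligible_sub u.2
  have h2 : IsNegligible fun ε => u.1 ε (q ε) - w.1 ε := hq none
  rw [← hw, delta_mk, ← sub_eq_zero, ← map_sub, mk_eq_zero_iff]
  change IsNegligible fun ε => w.1 ε - u.1 ε (p ε)
  simpa only [sub_sub_sub_cancel_left] using h1.sub h2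

theorem delta_mul (p : GenPoint E X) (u v : GenFun E X) :
    delta p (u * v) = delta p u * delta p v := by
  induction p using Quotient.inductionOn with
  | h p => exact map_mul (evalAtNet p) u v

theorem delta_add (p : GenPoint E X) (u v : GenFun E X) :
    delta p (u + v) = delta p u + delta p v := by
  induction p using Quotient.inductionOn with
  | h p => exact map_add (evalAtNet p) u v

theorem delta_one (p : GenPoint E X) : delta p (1 : GenFun E X) = 1 := by
  induction p using Quotient.inductionOn with
  | h p => exact map_one (evalAtNet p)

theorem delta_algebraMap (p : GenPoint E X) (z : GenNumber) :
    delta p (algebraMap GenNumber (GenFun E X) z) = z := by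
  induction p using Quotient.inductionOn with
  | h p =>
    obtain ⟨z, rfl⟩ := mk_surjective z
    rfl

theorem delta_smul (p : GenPoint E X) (z : GenNumber) (u : GenFun E X) :
    delta p (z • u) = z * delta p u := by
  rw [Algebra.smul_def, delta_mul, delta_algebraMap]

theorem isMultiplicativeLinear_mul_delta (p : GenPoint E X) {e : GenNumber}
    (he : IsIdempotentElem e) :
    IsMultiplicativeLinear fun u : GenFun E X => e * delta p u := by
  refine ⟨⟨fun u v => ?_, fun z u => ?_⟩, fun u v => ?_⟩
  · rw [delta_add, mul_add]
  · rw [delta_smul, smul_eq_mul, mul_left_comm]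
  · beta_reduce
    rw [delta_mul, mul_mul_mul_comm, he.eq]

theorem exists_eq_delta_of_map_one {φ : GenFun E X → GenNumber} (hφ : IsMultiplicativeLinear φ)
    (h1 : φ 1 = 1) : ∃ p : GenPoint E X, φ = delta p := by
  obtain ⟨p, hp⟩ := exists_eq_delta_of_algHom
    (AlgHom.ofLinearMap (IsLinearMap.mk' φ hφ.1) h1 hφ.2)
  exact ⟨p, funext hp⟩

theorem surjective_delta (p : GenPoint E X) :
    Function.Surjective (delta p : GenFun E X → GenNumber) :=
  fun z => ⟨_, delta_algebraMap p z⟩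

/-- The defect 1 - φ(1) is filled by evaluation at an arbitrary base point, which nonemptiness
supplies; multiplying by φ(1) removes it again. -/
theorem IsMultiplicativeLinear.exists_eq_mul_delta [Nonempty X] {φ : GenFun E X → GenNumber}
    (hφ : IsMultiplicativeLinear φ) : IsIdempotentElem (φ 1) ∧
      ∃ p : GenPoint E X, φ = fun u => φ 1 * delta p u := by
  have he : φ 1 * φ 1 = φ 1 := by rw [← hφ.2, mul_one]
  have heφ : ∀ u, φ 1 * φ u = φ u := fun u => by rw [← hφ.2, one_mul]
  refine ⟨he, ?_⟩
  obtain ⟨x⟩ := ‹Nonempty X›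
  let p₀ : GenPoint E X := Quotient.mk (pointSetoid E X)
    ⟨fun _ => x, {x}, isCompact_singleton, Eventually.of_forall fun _ => rfl⟩
  obtain ⟨p, hp⟩ := exists_eq_delta_of_map_one
    (φ := fun u => φ u + (1 - φ 1) * delta p₀ u) (by
      refine ⟨⟨fun u v => ?_, fun z u => ?_⟩, fun u v => ?_⟩
      · rw [hφ.1.map_add, delta_add]
        ring
      · rw [hφ.1.map_smul, delta_smul, smul_eq_mul, smul_eq_mul]
        ring
      · beta_reduce
        rw [hφ.2, delta_mul]
        -- The values of φ are fixed by e = φ(1), so the cross terms with 1 - e vanish, and 1 - e is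
        -- itself idempotent.
        linear_combination delta p₀ v * heφ u + delta p₀ u * heφ v -
          delta p₀ u * delta p₀ v * he) (by rw [delta_one]; ring)
  refine ⟨p, funext fun u => ?_⟩
  rw [← hp, mul_add, ← mul_assoc, mul_sub, mul_one, he, sub_self, zero_mul, add_zero, heφ]

end Characters

end Colombeau


theorem mainTheorem1 (E : Type*) [NormedAddCommGroup E] [NormedSpace ℝ E] [FiniteDimensional ℝ E]
    (X : Type*) [TopologicalSpace X] [T2Space X] [SecondCountableTopology X]
    [ChartedSpace E X] [IsManifold 𝓘(ℝ, E) ∞ X] :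
    {φ : Colombeau.GenFun E X → Colombeau.GenNumber |
        Colombeau.IsMultiplicativeLinear φ ∧ Function.Surjective φ} =
      {φ | ∃ p : Colombeau.GenPoint E X, φ = Colombeau.delta p} ∧
    (Nonempty X →
      {φ : Colombeau.GenFun E X → Colombeau.GenNumber | Colombeau.IsMultiplicativeLinear φ} =
        {φ | ∃ p : Colombeau.GenPoint E X, ∃ e ∈ Colombeau.realGenNumbers,
          IsIdempotentElem e ∧ φ = fun u => e * Colombeau.delta p u}) := by
  refine ⟨Set.Subset.antisymm ?_ ?_, fun hX => Set.Subset.antisymm ?_ ?_⟩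
  · rintro φ ⟨hφ, hs⟩
    exact Colombeau.exists_eq_delta_of_map_one hφ (hφ.map_one_of_surjective hs)
  · rintro φ ⟨p, rfl⟩
    refine ⟨?_, Colombeau.surjective_delta p⟩
    simpa only [one_mul] using
      Colombeau.isMultiplicativeLinear_mul_delta p (IsIdempotentElem.one (M := Colombeau.GenNumber))
  · intro φ hφ
    obtain ⟨he, p, hp⟩ := Colombeau.IsMultiplicativeLinear.exists_eq_mul_delta hφ
    obtain ⟨S, hS⟩ := Colombeau.exists_eq_mk_charNet he
    -- The idempotent φ(1) is real because its characteristic net takes only the values 0 and 1.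
    exact ⟨p, φ 1, hS ▸ Colombeau.mk_charNet_mem_realGenNumbers S, he, hp⟩
  · rintro φ ⟨p, e, -, he, rfl⟩
    exact Colombeau.isMultiplicativeLinear_mul_delta p he
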